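/- Let $n\ge 2$ and let $B_n$ be the group of real invertible upper triangular $n\times n$ matrices. Let $B_n^+\subset B_n$ be the set of totally positive matrices, i.e. those $G\in B_n$ for which every minor that does not vanish identically on $B_n$ is positive. For $I,J\subset\{1,\dots,n\}$ let $\Delta_I(G)$ be the minor of $G$ with rows $I$ and the last $|I|$ columns, let $\Delta^J(G)$ be the minor with the first $|J|$ rows and columns $J$, and put $\Delta_\emptyset=\Delta^\emptyset=1$ and $\bar I=\{n+1-a : a\in I\}$. Write $[a,b]=\{i\in\mathbb N : a\le i\le b\}$ (empty if $b<a$), and let $$l(x)=\frac{6}{\pi^2}L\Bigl(\frac{x}{1+x}\Bigr)\quad(x>0),\qquad L(x)=\sum_{k\ge1}\frac{x^k}{k^2}+\frac12\log x\,\log(1-x)\quad(0<x<1).$$ For $1\le a<b<c\le n$ set (all minors being those of the matrix $G$) $$Y_{abc}=\frac{\Delta_{[a,b-1]\cup[c+1,n]}\,\Delta_{[a+1,b]\cup[c,n]}}{\Delta_{[a,b]\cup[c+1,n]}\,\Delta_{[a+1,b-1]\cup[c,n]}},\qquad \tilde Y_{abc}=\frac{\Delta_{[1,a]\cup[b+1,c-1]}\,\Delta_{[1,a-1]\cup[b,c]}}{\Delta_{[1,a]\cup[b,c-1]}\,\Delta_{[1,a-1]\cup[b+1,c]}},$$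 $$Y^{abc}=\frac{\Delta^{[a,b]\cup[c+1,n]}\,\Delta^{[a+1,b-1]\cup[c,n]}}{\Delta^{[a,b-1]\cup[c+1,n]}\,\Delta^{[a+1,b]\cup[c,n]}},\qquad \tilde Y^{abc}=\frac{\Delta^{[1,a]\cup[b,c-1]}\,\Delta^{[1,a-1]\cup[b+1,c]}}{\Delta^{[1,a]\cup[b+1,c-1]}\,\Delta^{[1,a-1]\cup[b,c]}}.$$ **Theorem.** For every $G\in B_n^+$ there are a unique $\check G\in B_n^+$ with $\Delta_I(\check G)=\Delta_{\bar I}(G)$ for all $I\subset\{1,\dots,n\}$ and a unique $\hat G\in B_n^+$ with $\Delta^J(\hat G)=\Delta^{\bar J}(G)$ for all $J\subset\{1,\dots,n\}$, and, all sums being over the triples of integers $1\le a<b<c\le n$, $$\begin{aligned} &\sum l\bigl(Y_{abc}(\check G)\bigr)=\sum l\Bigl(\frac1{Y_{abc}(G)}\Bigr)=\sum l\bigl(Y_{abc}(\hat G)\bigr)\\ ={}&\sum l\bigl(\tilde Y^{abc}(\check G)\bigr)=\sum l\Bigl(\frac1{\tilde Y^{abc}(G)}\Bigr)=\sum l\bigl(\tilde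 Y^{abc}(\hat G)\bigr)\\ ={}&\sum l\bigl(\tilde Y_{abc}(\check G)\bigr)=\sum l\Bigl(\frac1{\tilde Y_{abc}(G)}\Bigr)=\sum l\bigl(\tilde Y_{abc}(\hat G)\bigr)\\ ={}&\sum l\bigl(Y^{abc}(\check G)\bigr)=\sum l\Bigl(\frac1{Y^{abc}(G)}\Bigr)=\sum l\bigl(Y^{abc}(\hat G)\bigr). \end{aligned}$$ -/

import Mathlib

open scoped BigOperators

namespace TotPosDilog

/-- The dilogarithm `Li₂(x) = ∑_{k ≥ 1} x ^ k / k ^ 2` (convergent for `|x| ≤ 1`). -/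
noncomputable def Li2 (x : ℝ) : ℝ := ∑' k : ℕ, x ^ (k + 1) / ((k : ℝ) + 1) ^ 2

/-- The Rogers dilogarithm; used only for `0 < x < 1`. -/
noncomputable def rogersL (x : ℝ) : ℝ := Li2 x + 1 / 2 * Real.log x * Real.log (1 - x)

/-- The function `l(x) = (6 / π²) L(x / (1 + x))`; used only for `x > 0`. -/
noncomputable def ell (x : ℝ) : ℝ := 6 / Real.pi ^ 2 * rogersL (x / (1 + x))

/-- `B_n`: the real invertible upper triangular `n × n` matrices. -/
def B (n : ℕ) : Set (Matrix (Fin n) (Fin n) ℝ) :=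
  {G | (∀ i j : Fin n, j < i → G i j = 0) ∧ IsUnit G}

/-- `B_n⁺`: those `G ∈ B_n` for which every minor (rows `r 0 < r 1 < ⋯`, columns
`c 0 < c 1 < ⋯`) that does not vanish identically on `B_n` is positive. -/
def BPlus (n : ℕ) : Set (Matrix (Fin n) (Fin n) ℝ) :=
  {G | G ∈ B n ∧ ∀ (k : ℕ) (r c : Fin k ↪o Fin n),
    (∃ H ∈ B n, (H.submatrix r c).det ≠ 0) → 0 < (G.submatrix r c).det}

/-- The right flag minor `Δ_I(G)`: rows in `I` (in increasing order), last `|I|` columns. -/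
noncomputable def rightMinor {n : ℕ} (G : Matrix (Fin n) (Fin n) ℝ) (I : Finset (Fin n)) : ℝ :=
  (Matrix.of fun i j : Fin I.card =>
    G (I.orderEmbOfFin rfl i)
      ⟨n - I.card + j, by have := I.card_le_univ; have := j.2; simp at *; omega⟩).det

/-- The upper flag minor `Δ^J(G)`: first `|J|` rows, columns in `J` (in increasing order). -/
noncomputable def upperMinor {n : ℕ} (G : Matrix (Fin n) (Fin n) ℝ) (J : Finset (Fin n)) : ℝ :=
  (Matrix.of fun i j : Fin J.card =>
    G ⟨i, by have := J.card_le_univ; have := i.2; simp at *; omega⟩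
      (J.orderEmbOfFin rfl j)).det

/-- The reversed index set `Ī = {n + 1 - a | a ∈ I}`. -/
def bar {n : ℕ} (I : Finset (Fin n)) : Finset (Fin n) := I.image Fin.rev

/-- `H` is `Ǧ`: it lies in `B_n⁺` and `Δ_I(H) = Δ_Ī(G)` for all `I`. -/
def IsCheck {n : ℕ} (G H : Matrix (Fin n) (Fin n) ℝ) : Prop :=
  H ∈ BPlus n ∧ ∀ I : Finset (Fin n), rightMinor H I = rightMinor G (bar I)

/-- `H` is `Ĝ`: it lies in `B_n⁺` and `Δ^J(H) = Δ^J̄(G)` for all `J`. -/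
def IsHat {n : ℕ} (G H : Matrix (Fin n) (Fin n) ℝ) : Prop :=
  H ∈ BPlus n ∧ ∀ J : Finset (Fin n), upperMinor H J = upperMinor G (bar J)

/-- The interval `[a, b]` of the one-based labels `1, …, n`, as a set of zero-based indices;
it is empty if `b < a`. -/
def seg (n a b : ℕ) : Finset (Fin n) :=
  Finset.univ.filter fun i : Fin n => a ≤ (i : ℕ) + 1 ∧ (i : ℕ) + 1 ≤ b

/-- The discrete tetrahedron: the triples `1 ≤ a < b < c ≤ n`. -/
def T (n : ℕ) : Finset (ℕ × ℕ × ℕ) :=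
  (Finset.Icc 1 n ×ˢ Finset.Icc 1 n ×ˢ Finset.Icc 1 n).filter
    fun t => t.1 < t.2.1 ∧ t.2.1 < t.2.2

variable {n : ℕ}

/-- `Y_{abc}(G)`. -/
noncomputable def Ylow (G : Matrix (Fin n) (Fin n) ℝ) (a b c : ℕ) : ℝ :=
  (rightMinor G (seg n a (b - 1) ∪ seg n (c + 1) n) *
      rightMinor G (seg n (a + 1) b ∪ seg n c n)) /
    (rightMinor G (seg n a b ∪ seg n (c + 1) n) *
      rightMinor G (seg n (a + 1) (b - 1) ∪ seg n c n))

/-- `Ỹ_{abc}(G)`. -/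
noncomputable def Ytlow (G : Matrix (Fin n) (Fin n) ℝ) (a b c : ℕ) : ℝ :=
  (rightMinor G (seg n 1 a ∪ seg n (b + 1) (c - 1)) *
      rightMinor G (seg n 1 (a - 1) ∪ seg n b c)) /
    (rightMinor G (seg n 1 a ∪ seg n b (c - 1)) *
      rightMinor G (seg n 1 (a - 1) ∪ seg n (b + 1) c))

/-- `Y^{abc}(G)`. -/
noncomputable def Yup (G : Matrix (Fin n) (Fin n) ℝ) (a b c : ℕ) : ℝ :=
  (upperMinor G (seg n a b ∪ seg n (c + 1) n) *
      upperMinor G (seg n (a + 1) (b - 1) ∪ seg n c n)) /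
    (upperMinor G (seg n a (b - 1) ∪ seg n (c + 1) n) *
      upperMinor G (seg n (a + 1) b ∪ seg n c n))

/-- `Ỹ^{abc}(G)`. -/
noncomputable def Ytup (G : Matrix (Fin n) (Fin n) ℝ) (a b c : ℕ) : ℝ :=
  (upperMinor G (seg n 1 a ∪ seg n b (c - 1)) *
      upperMinor G (seg n 1 (a - 1) ∪ seg n (b + 1) c)) /
    (upperMinor G (seg n 1 a ∪ seg n (b + 1) (c - 1)) *
      upperMinor G (seg n 1 (a - 1) ∪ seg n b c))

/-- `∑_{(a,b,c) ∈ T_n} l(Z_{abc})`. -/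
noncomputable def dilogSum (n : ℕ) (Z : ℕ → ℕ → ℕ → ℝ) : ℝ :=
  ∑ t ∈ T n, ell (Z t.1 t.2.1 t.2.2)

/-- `∑_{(a,b,c) ∈ T_n} l(1 / Z_{abc})`. -/
noncomputable def dilogSumInv (n : ℕ) (Z : ℕ → ℕ → ℕ → ℝ) : ℝ :=
  ∑ t ∈ T n, ell (1 / Z t.1 t.2.1 t.2.2)

end TotPosDilog

/-
The flag minors satisfy the three-term Plücker relations, and these feed the five-term relation of
the dilogarithm: two pentagons that share a cross-ratio combine into an identity between eight
terms `l(exchange ratio)` attached to the faces of a tetrahedron `p < q < r < s`. Moving the labels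
`1, 2, …, n` one at a time across the three labels `a < b < c` deforms `Y_{abc}` into `Ỹ_{abc}`, and
the changes cancel when every label of a quadruple is moved across the other three, so
`∑ l(Y_{abc}) = ∑ l(Ỹ_{abc})`, and likewise `∑ l(1 / Y^{abc}) = ∑ l(1 / Ỹ^{abc})`. Since `G` is
triangular, the flag minors in these ratios factor into minors with consecutive rows and columns,
which gives `Y_{abc} = Ỹ^{a, a + c - b, c}`. The reflection formula `l(x) + l(1 / x) = 2 l(1)`
turns an equality of sums of `l(Z)` into one of sums of `l(1 / Z)`. Passing to `Ǧ` or `Ĝ` reverses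
the labels.

`Ĝ` is the upper triangular factor in an LU decomposition of `G` with reversed columns and suitable
row signs. It has positive flag minors, and this suffices for total positivity by a Fekete-type
argument: a gap in the row set of a minor is filled by means of the three-term relation, by
induction on the size plus the diameter of the row set, until the rows are consecutive. `Ǧ` is
obtained from `Ĝ` by reflection in the antidiagonal.
-/

namespace TotPosDilog

section Dilogarithm

open Set

theorem hasDerivAt_Li2_tsum {x : ℝ} (hx : |x| < 1) :
    HasDerivAt Li2 (∑' k : ℕ, x ^ k / ((k : ℝ) + 1)) x := by
  obtain ⟨r, hxr, hr⟩ := exists_between hx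
  have hr0 : 0 < r := (abs_nonneg x).trans_lt hxr
  refine hasDerivAt_tsum_of_isPreconnected (t := Ioo (-r) r) (y₀ := 0)
    (u := fun k : ℕ => r ^ k) (g := fun (k : ℕ) (x : ℝ) => x ^ (k + 1) / ((k : ℝ) + 1) ^ 2)
    (g' := fun (k : ℕ) (x : ℝ) => x ^ k / ((k : ℝ) + 1))
    (summable_geometric_of_lt_one hr0.le hr) isOpen_Ioo isPreconnected_Ioo
    (fun k y _ => ?_) (fun k y hy => ?_) ⟨neg_lt_zero.2 hr0, hr0⟩ (by simp) (abs_lt.1 hxr)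
  · refine ((hasDerivAt_pow (k + 1) y).div_const (((k : ℝ) + 1) ^ 2)).congr_deriv ?_
    push_cast
    field_simp
  · rw [Real.norm_eq_abs, abs_div, abs_pow, abs_of_pos (by positivity : (0 : ℝ) < (k : ℝ) + 1)]
    calc |y| ^ k / ((k : ℝ) + 1) ≤ |y| ^ k :=
          div_le_self (by positivity) (by linarith [Nat.cast_nonneg (α := ℝ) k])
      _ ≤ r ^ k := pow_le_pow_left₀ (abs_nonneg y) (abs_lt.2 hy).le k

theorem hasDerivAt_Li2 {x : ℝ} (hx0 : 0 < x) (hx1 : x < 1) :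
    HasDerivAt Li2 (-Real.log (1 - x) / x) x := by
  have hx : |x| < 1 := by rwa [abs_of_pos hx0]
  refine (hasDerivAt_Li2_tsum hx).congr_deriv ?_
  rw [← ((Real.hasSum_pow_div_log_of_abs_lt_one hx).div_const x).tsum_eq]
  refine tsum_congr fun k => ?_
  field_simp
  ring

theorem hasDerivAt_rogersL {x : ℝ} (hx0 : 0 < x) (hx1 : x < 1) :
    HasDerivAt rogersL (-(1 / 2) * (Real.log (1 - x) / x + Real.log x / (1 - x))) x := by
  have hx : 1 - x ≠ 0 := by linarith
  have hlog : HasDerivAt (fun x : ℝ => Real.log (1 - x)) (-1 / (1 - x)) x :=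
    ((hasDerivAt_id x).const_sub 1).log hx
  refine ((hasDerivAt_Li2 hx0 hx1).add
    (((Real.hasDerivAt_log hx0.ne').const_mul (1 / 2 : ℝ)).mul hlog)).congr_deriv ?_
  field_simp
  ring

theorem hasDerivAt_ell {y : ℝ} (hy : 0 < y) :
    HasDerivAt ell (3 / Real.pi ^ 2 * (Real.log (1 + y) / y - Real.log y / (1 + y))) y := by
  have hy1 : 0 < 1 + y := by linarith
  have hdiv : HasDerivAt (fun y : ℝ => y / (1 + y)) (1 / (1 + y) ^ 2) y :=
    ((hasDerivAt_id y).div ((hasDerivAt_id y).const_add 1) hy1.ne').congr_deriv (by simp)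
  have hlt : y / (1 + y) < 1 := by rw [div_lt_one hy1]; linarith
  refine (((hasDerivAt_rogersL (by positivity) hlt).comp y hdiv).const_mul
    (6 / Real.pi ^ 2)).congr_deriv ?_
  have hsub : 1 - y / (1 + y) = 1 / (1 + y) := by field_simp; ring
  rw [hsub, Real.log_div hy.ne' hy1.ne', one_div (1 + y), Real.log_inv]
  field_simp
  ring

theorem eq_of_hasDerivAt_zero_of_pos {f : ℝ → ℝ} (h : ∀ x, 0 < x → HasDerivAt f 0 x) {x y : ℝ}
    (hx : 0 < x) (hy : 0 < y) : f x = f y :=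
  isOpen_Ioi.is_const_of_deriv_eq_zero isPreconnected_Ioi
    (fun z hz => (h z hz).differentiableAt.differentiableWithinAt)
    (fun z hz => (h z hz).deriv) hx hy

theorem ell_add_ell_one_div {x : ℝ} (hx : 0 < x) : ell x + ell (1 / x) = 2 * ell 1 := by
  suffices h : ∀ x, 0 < x → HasDerivAt (fun x => ell x + ell (1 / x)) 0 x by
    rw [eq_of_hasDerivAt_zero_of_pos h hx one_pos, div_one, two_mul]
  intro x hx
  have hinv : HasDerivAt (fun x : ℝ => 1 / x) (-(x ^ 2)⁻¹) x := by
    simpa only [one_div] using hasDerivAt_inv hx.ne'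
  refine ((hasDerivAt_ell hx).add
    ((hasDerivAt_ell (one_div_pos.2 hx)).comp x hinv)).congr_deriv ?_
  have hx1 : 0 < 1 + x := by linarith
  have hadd : 1 + 1 / x = (1 + x) / x := by field_simp; ring
  rw [hadd, Real.log_div hx1.ne' hx.ne', one_div, Real.log_inv]
  field_simp
  ring

/-- The defect of the five-term relation of the dilogarithm, in a homogeneous form with the five
arguments of `ell` parametrized by `u`, `v`, `w`. It is in fact zero; only its constancy
matters here, because every identity below is a difference of two five-term relations. -/
noncomputable def fiveTermDefect (u v w : ℝ) : ℝ :=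
  ell ((v + w) / u) + ell (w / v) -
    (ell (v / u) + ell (w / (u + v)) + ell (u * w / ((u + v + w) * v)))

theorem hasDerivAt_fiveTermDefect {u v w : ℝ} (hu : 0 < u) (hv : 0 < v) (hw : 0 < w) :
    HasDerivAt (fiveTermDefect u v) 0 w := by
  have huv : 0 < u + v := by positivity
  have hvw : 0 < v + w := by positivity
  have hs : 0 < u + v + w := by positivity
  have h₁ := (hasDerivAt_ell (div_pos hvw hu)).comp w
    (((hasDerivAt_id w).const_add v).div_const u)
  have h₂ := (hasDerivAt_ell (div_pos hw hv)).comp w ((hasDerivAt_id w).div_const v)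
  have h₃ := (hasDerivAt_ell (div_pos hw huv)).comp w ((hasDerivAt_id w).div_const (u + v))
  have h₄ := (hasDerivAt_ell (div_pos (mul_pos hu hw) (mul_pos hs hv))).comp w
    (((hasDerivAt_id w).const_mul u).div (((hasDerivAt_id w).const_add (u + v)).mul_const v)
      (mul_pos hs hv).ne')
  refine ((h₁.add h₂).sub ((h₃.const_add (ell (v / u))).add h₄)).congr_deriv ?_
  have e₁ : 1 + (v + w) / u = (u + v + w) / u := by field_simp; ring
  have e₂ : 1 + w / v = (v + w) / v := by field_simp
  have e₃ : 1 + w / (u + v) = (u + v + w) / (u + v) := by field_simp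
  have e₄ : 1 + u * w / ((u + v + w) * v) = (u + v) * (v + w) / ((u + v + w) * v) := by
    field_simp; ring
  simp only [id]
  rw [e₁, e₂, e₃, e₄, Real.log_div hs.ne' hu.ne', Real.log_div hvw.ne' hu.ne',
    Real.log_div hvw.ne' hv.ne', Real.log_div hw.ne' hv.ne', Real.log_div hs.ne' huv.ne',
    Real.log_div hw.ne' huv.ne', Real.log_div (mul_pos huv hvw).ne' (mul_pos hs hv).ne',
    Real.log_div (mul_pos hu hw).ne' (mul_pos hs hv).ne', Real.log_mul huv.ne' hvw.ne',
    Real.log_mul hs.ne' hv.ne', Real.log_mul hu.ne' hw.ne']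
  field_simp
  ring

theorem fiveTermDefect_swap {u v w : ℝ} (hu : 0 < u) (hv : 0 < v) (hw : 0 < w) :
    fiveTermDefect w v u = fiveTermDefect u v w := by
  have h₁ := ell_add_ell_one_div (div_pos (add_pos hv hw) hu)
  have h₂ := ell_add_ell_one_div (div_pos hw hv)
  have h₃ := ell_add_ell_one_div (div_pos hv hu)
  have h₄ := ell_add_ell_one_div (div_pos hw (add_pos hu hv))
  rw [one_div_div] at h₁ h₂ h₃ h₄
  rw [fiveTermDefect, fiveTermDefect, add_comm w v, add_comm v u, mul_comm w u,
    show v + w + u = u + v + w by ring]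
  linarith

theorem fiveTermDefect_eq {u v w : ℝ} (hu : 0 < u) (hv : 0 < v) (hw : 0 < w) :
    fiveTermDefect u v w = fiveTermDefect 1 1 1 := by
  have hconst {u v w w' : ℝ} (hu : 0 < u) (hv : 0 < v) (hw : 0 < w) (hw' : 0 < w') :
      fiveTermDefect u v w = fiveTermDefect u v w' :=
    eq_of_hasDerivAt_zero_of_pos (fun _ => hasDerivAt_fiveTermDefect hu hv) hw hw'
  calc fiveTermDefect u v w = fiveTermDefect u v v := hconst hu hv hw hv
    _ = fiveTermDefect v v u := (fiveTermDefect_swap hu hv hv).symm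
    _ = fiveTermDefect v v v := hconst hv hv hu hv
    _ = fiveTermDefect 1 1 1 := by
      have h₁ : (v + v) / v = (1 + 1) / 1 := by field_simp
      have h₂ : v / v = 1 / 1 := by field_simp
      have h₃ : v / (v + v) = 1 / (1 + 1) := by field_simp
      have h₄ : v * v / ((v + v + v) * v) = 1 * 1 / ((1 + 1 + 1) * 1) := by field_simp
      rw [fiveTermDefect, fiveTermDefect, h₁, h₂, h₃, h₄]

end Dilogarithm

/-- The exchange ratio `F(S ∪ a) F(S ∪ bc) / (F(S ∪ ab) F(S ∪ c))`: each of the ratios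
`Y`, `Ỹ`, or its reciprocal, has this form, with `F` a flag minor. -/
noncomputable def exchangeRatio (F : Set ℕ → ℝ) (S : Set ℕ) (a b c : ℕ) : ℝ :=
  (F (insert a S) * F (insert b (insert c S))) / (F (insert a (insert b S)) * F (insert c S))

/-- The ratio of the products of `F` over opposite sides `pq, rs` and `ps, qr` of the
quadrilateral `p, q, r, s`. -/
noncomputable def crossRatio (F : Set ℕ → ℝ) (S : Set ℕ) (p q r s : ℕ) : ℝ :=
  (F (insert p (insert q S)) * F (insert r (insert s S))) /
    (F (insert p (insert s S)) * F (insert q (insert r S)))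

/-- The three-term Plücker relations between the values of `F` for the labels `1, …, n`. -/
def ThreeTerm (n : ℕ) (F : Set ℕ → ℝ) : Prop :=
  ∀ (S : Set ℕ) (a b c : ℕ), 1 ≤ a → a < b → b < c → c ≤ n → a ∉ S → b ∉ S → c ∉ S →
    F (insert b S) * F (insert a (insert c S)) =
      F (insert a S) * F (insert b (insert c S)) + F (insert c S) * F (insert a (insert b S))

-- The five arguments are those of `fiveTermDefect` at `u = f₁₂ / (f₁ f₂)`, `v = f₂₃ / (f₂ f₃)`,
-- `w = f₃₄ / (f₃ f₄)`, which are additive along `1, 2, 3, 4`: the relations say for instance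
-- that `u + v = f₁₃ / (f₁ f₃)`.
theorem ell_pentagon {f₁ f₂ f₃ f₄ f₁₂ f₁₃ f₁₄ f₂₃ f₂₄ f₃₄ : ℝ}
    (h₁ : 0 < f₁) (h₂ : 0 < f₂) (h₃ : 0 < f₃) (h₄ : 0 < f₄)
    (h₁₂ : 0 < f₁₂) (h₂₃ : 0 < f₂₃) (h₃₄ : 0 < f₃₄)
    (r₁₂₃ : f₂ * f₁₃ = f₁ * f₂₃ + f₃ * f₁₂) (r₁₂₄ : f₂ * f₁₄ = f₁ * f₂₄ + f₄ * f₁₂)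
    (r₁₃₄ : f₃ * f₁₄ = f₁ * f₃₄ + f₄ * f₁₃) :
    ell (f₁ * f₂₄ / (f₁₂ * f₄)) + ell (f₂ * f₃₄ / (f₂₃ * f₄)) =
      ell (f₁ * f₂₃ / (f₁₂ * f₃)) + ell (f₁ * f₃₄ / (f₁₃ * f₄)) +
        ell (f₁₂ * f₃₄ / (f₁₄ * f₂₃)) + fiveTermDefect 1 1 1 := by
  set u := f₁₂ / (f₁ * f₂) with hu
  set v := f₂₃ / (f₂ * f₃) with hv
  set w := f₃₄ / (f₃ * f₄) with hw
  have hu0 : 0 < u := by positivity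
  have hv0 : 0 < v := by positivity
  have hw0 : 0 < w := by positivity
  have e₁₂ : f₁₂ = f₁ * f₂ * u := by rw [hu]; field_simp
  have e₂₃ : f₂₃ = f₂ * f₃ * v := by rw [hv]; field_simp
  have e₃₄ : f₃₄ = f₃ * f₄ * w := by rw [hw]; field_simp
  have e₁₃ : f₁₃ = f₁ * f₃ * (u + v) := by
    refine mul_left_cancel₀ h₂.ne' ?_
    rw [r₁₂₃, e₁₂, e₂₃]; ring
  have e₁₄ : f₁₄ = f₁ * f₄ * (u + v + w) := by
    refine mul_left_cancel₀ h₃.ne' ?_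
    rw [r₁₃₄, e₁₃, e₃₄]; ring
  have e₂₄ : f₂₄ = f₂ * f₄ * (v + w) := by
    refine mul_left_cancel₀ h₁.ne' ?_
    rw [e₁₂, e₁₄] at r₁₂₄
    linear_combination -r₁₂₄
  have h := fiveTermDefect_eq hu0 hv0 hw0
  rw [fiveTermDefect, sub_eq_iff_eq_add'] at h
  convert h using 3
  · rw [e₂₄, e₁₂]; field_simp
  · rw [e₃₄, e₂₃]; field_simp
  · congr 2
    · rw [e₂₃, e₁₂]; field_simp
    · rw [e₃₄, e₁₃]; field_simp
  · rw [e₁₂, e₃₄, e₁₄, e₂₃]; field_simp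

section Tetrahedron

variable {n : ℕ} {F : Set ℕ → ℝ} {S : Set ℕ} {p q r s : ℕ}

theorem ThreeTerm.ell_exchangeRatio_pentagon (hF : ThreeTerm n F) (hpos : ∀ S, 0 < F S)
    (hp1 : 1 ≤ p) (hpq : p < q) (hqr : q < r) (hrs : r < s) (hsn : s ≤ n)
    (hp : p ∉ S) (hq : q ∉ S) (hr : r ∉ S) (hs : s ∉ S) :
    ell (exchangeRatio F S p q s) + ell (exchangeRatio F S q r s) =
      ell (exchangeRatio F S p q r) + ell (exchangeRatio F S p r s) +
        ell (crossRatio F S p q r s) + fiveTermDefect 1 1 1 :=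
  ell_pentagon (hpos _) (hpos _) (hpos _) (hpos _) (hpos _) (hpos _) (hpos _)
    (hF S p q r hp1 hpq hqr (by omega) hp hq hr)
    (hF S p q s hp1 hpq (by omega) hsn hp hq hs)
    (hF S p r s hp1 (by omega) hrs hsn hp hr hs)

theorem ThreeTerm.ell_exchangeRatio_insert_pentagon (hF : ThreeTerm n F) (hpos : ∀ S, 0 < F S)
    (hp1 : 1 ≤ p) (hpq : p < q) (hqr : q < r) (hrs : r < s) (hsn : s ≤ n)
    (hp : p ∉ S) (hq : q ∉ S) (hr : r ∉ S) (hs : s ∉ S) :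
    ell (exchangeRatio F (insert r S) p q s) + ell (exchangeRatio F (insert p S) q r s) =
      ell (exchangeRatio F (insert s S) p q r) + ell (exchangeRatio F (insert q S) p r s) +
        ell (crossRatio F S p q r s) + fiveTermDefect 1 1 1 := by
  have not_mem_insert {x y : ℕ} (hxy : x ≠ y) (hx : x ∉ S) : x ∉ insert y S := by
    simp only [Set.mem_insert_iff, hxy, hx, or_self, not_false_eq_true]
  have r₁ := hF (insert s S) p q r hp1 hpq hqr (by omega) (not_mem_insert (by omega) hp)
    (not_mem_insert (by omega) hq) (not_mem_insert (by omega) hr)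
  have r₂ := hF (insert r S) p q s hp1 hpq (by omega) hsn (not_mem_insert (by omega) hp)
    (not_mem_insert (by omega) hq) (not_mem_insert (by omega) hs)
  have r₃ := hF (insert q S) p r s hp1 (by omega) hrs hsn (not_mem_insert (by omega) hp)
    (not_mem_insert (by omega) hr) (not_mem_insert (by omega) hs)
  simp only [Set.insert_comm] at r₁ r₂ r₃
  have key := ell_pentagon (hpos (insert q (insert r (insert s S))))
    (hpos (insert p (insert r (insert s S)))) (hpos (insert p (insert q (insert s S))))
    (hpos (insert p (insert q (insert r S))))
    (f₁₂ := F (insert r (insert s S))) (f₁₃ := F (insert q (insert s S)))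
    (f₁₄ := F (insert q (insert r S))) (f₂₃ := F (insert p (insert s S)))
    (f₂₄ := F (insert p (insert r S))) (f₃₄ := F (insert p (insert q S)))
    (hpos _) (hpos _) (hpos _) (by linarith) (by linarith) (by linarith)
  simp only [exchangeRatio, crossRatio, Set.insert_comm, mul_comm] at key ⊢
  exact key

theorem ThreeTerm.ell_tetrahedron (hF : ThreeTerm n F) (hpos : ∀ S, 0 < F S)
    (hp1 : 1 ≤ p) (hpq : p < q) (hqr : q < r) (hrs : r < s) (hsn : s ≤ n)
    (hp : p ∉ S) (hq : q ∉ S) (hr : r ∉ S) (hs : s ∉ S) :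
    ell (exchangeRatio F S q r s) + ell (exchangeRatio F (insert q S) p r s) +
        ell (exchangeRatio F S p q s) + ell (exchangeRatio F (insert s S) p q r) =
      ell (exchangeRatio F (insert p S) q r s) + ell (exchangeRatio F S p r s) +
        ell (exchangeRatio F (insert r S) p q s) + ell (exchangeRatio F S p q r) := by
  linarith [hF.ell_exchangeRatio_pentagon hpos hp1 hpq hqr hrs hsn hp hq hr hs,
    hF.ell_exchangeRatio_insert_pentagon hpos hp1 hpq hqr hrs hsn hp hq hr hs]

end Tetrahedron

section TripleSums

variable {M : Type*}

theorem ite_lt_lt_eq_sum_insert [AddMonoid M] {a b c m : ℕ} {x : M}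
    (hx : a < b → b < c → m = a ∨ m = b ∨ m = c → x = 0) :
    (if a < b ∧ b < c then x else 0) =
      (if m < a ∧ a < b ∧ b < c then x else 0) + (if a < m ∧ m < b ∧ b < c then x else 0) +
        (if a < b ∧ b < m ∧ m < c then x else 0) + if a < b ∧ b < c ∧ c < m then x else 0 := by
  split_ifs <;> first | omega | simp only [add_zero, zero_add]
  exact hx (by omega) (by omega) (by omega)

theorem sum_T [AddCommMonoid M] (n : ℕ) (f : ℕ → ℕ → ℕ → M) :
    ∑ t ∈ T n, f t.1 t.2.1 t.2.2 =
      ∑ a ∈ Finset.Icc 1 n, ∑ b ∈ Finset.Icc 1 n, ∑ c ∈ Finset.Icc 1 n,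
        if a < b ∧ b < c then f a b c else 0 := by
  simp only [T, Finset.sum_filter, Finset.sum_product]

theorem sum_T_sum_Icc [AddCommMonoid M] (n : ℕ) (h : ℕ → ℕ → ℕ → ℕ → M)
    (hdiag : ∀ a b c m, a < b → b < c → m = a ∨ m = b ∨ m = c → h a b c m = 0) :
    ∑ t ∈ T n, ∑ m ∈ Finset.Icc 1 n, h t.1 t.2.1 t.2.2 m =
      ∑ p ∈ Finset.Icc 1 n, ∑ q ∈ Finset.Icc 1 n, ∑ r ∈ Finset.Icc 1 n, ∑ s ∈ Finset.Icc 1 n,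
        if p < q ∧ q < r ∧ r < s then h q r s p + h p r s q + h p q s r + h p q r s else 0 := by
  have split_ite (a b c m : ℕ) := ite_lt_lt_eq_sum_insert (hdiag a b c m)
  have swap_last (f : ℕ → ℕ → ℕ → ℕ → M) (a b : ℕ) :
      ∑ c ∈ Finset.Icc 1 n, ∑ m ∈ Finset.Icc 1 n, f a b c m =
        ∑ c ∈ Finset.Icc 1 n, ∑ m ∈ Finset.Icc 1 n, f a b m c := Finset.sum_comm
  have swap_mid (f : ℕ → ℕ → ℕ → ℕ → M) (a : ℕ) :
      ∑ b ∈ Finset.Icc 1 n, ∑ c ∈ Finset.Icc 1 n, ∑ m ∈ Finset.Icc 1 n, f a b c m =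
        ∑ b ∈ Finset.Icc 1 n, ∑ c ∈ Finset.Icc 1 n, ∑ m ∈ Finset.Icc 1 n, f a c m b := by
    simp only [swap_last f]
    exact Finset.sum_comm
  have swap_first (f : ℕ → ℕ → ℕ → ℕ → M) :
      ∑ a ∈ Finset.Icc 1 n, ∑ b ∈ Finset.Icc 1 n, ∑ c ∈ Finset.Icc 1 n, ∑ m ∈ Finset.Icc 1 n,
          f a b c m =
        ∑ a ∈ Finset.Icc 1 n, ∑ b ∈ Finset.Icc 1 n, ∑ c ∈ Finset.Icc 1 n, ∑ m ∈ Finset.Icc 1 n,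
          f b c m a := by
    simp only [swap_mid f]
    exact Finset.sum_comm
  have ite_add_add_add (P : Prop) [Decidable P] (w x y z : M) :
      (if P then w + x + y + z else 0) =
        (if P then w else 0) + (if P then x else 0) + (if P then y else 0) +
          if P then z else 0 := by
    split_ifs <;> simp only [add_zero]
  have ite_sum (P : Prop) [Decidable P] (f : ℕ → M) :
      (if P then ∑ m ∈ Finset.Icc 1 n, f m else 0) =
        ∑ m ∈ Finset.Icc 1 n, if P then f m else 0 := by
    split_ifs <;> simp only [Finset.sum_const_zero]
  rw [sum_T n fun a b c => ∑ m ∈ Finset.Icc 1 n, h a b c m]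
  simp only [ite_sum, split_ite, ite_add_add_add, Finset.sum_add_distrib]
  refine congrArg₂ _ (congrArg₂ _ (congrArg₂ _ ?_ ?_) ?_) rfl
  · exact swap_first fun a b c m => if m < a ∧ a < b ∧ b < c then h a b c m else 0
  · exact Finset.sum_congr rfl fun a _ =>
      swap_mid (fun a b c m => if a < m ∧ m < b ∧ b < c then h a b c m else 0) a
  · exact Finset.sum_congr rfl fun a _ => Finset.sum_congr rfl fun b _ =>
      swap_last (fun a b c m => if a < b ∧ b < m ∧ m < c then h a b c m else 0) a b

end TripleSums

/-- The path of label sets that joins, for fixed `a < b < c`, the set `[a + 1, b - 1] ∪ [c + 1, n]`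
of common labels of `Y_{abc}` (at `m = 0`) to the set `[1, a - 1] ∪ [b + 1, c - 1]` of common
labels of `Ỹ_{abc}` (at `m = n`). Every label other than `a`, `b`, `c` belongs to exactly one end
and crosses to the other side when `m` passes it; labels above `n` play no role. -/
def pathSet (a b c m : ℕ) : Set ℕ :=
  {y | (y < a ∧ y ≤ m) ∨ (a < y ∧ y < b ∧ m < y) ∨ (b < y ∧ y < c ∧ y ≤ m) ∨ (c < y ∧ m < y)}

theorem pathSet_pred_of_mem {a b c m : ℕ} (hab : a < b) (hbc : b < c)
    (hm : m = a ∨ m = b ∨ m = c) : pathSet a b c (m - 1) = pathSet a b c m := by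
  ext y
  simp only [pathSet, Set.mem_ofPred_eq]
  omega

/-- The function `l` of the exchange ratio of `a`, `b`, `c` after `m` steps of the path. -/
noncomputable def pathEll (F : Set ℕ → ℝ) (a b c m : ℕ) : ℝ :=
  ell (exchangeRatio F (pathSet a b c m) a b c)

theorem ThreeTerm.pathEll_quadruple {n : ℕ} {F : Set ℕ → ℝ} (hF : ThreeTerm n F)
    (hpos : ∀ S, 0 < F S) {p q r s : ℕ} (hp1 : 1 ≤ p) (hpq : p < q) (hqr : q < r) (hrs : r < s)
    (hsn : s ≤ n) :
    pathEll F q r s (p - 1) + pathEll F p r s (q - 1) + pathEll F p q s (r - 1) +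
        pathEll F p q r (s - 1) =
      pathEll F q r s p + pathEll F p r s q + pathEll F p q s r + pathEll F p q r s := by
  let S : Set ℕ := {y | y < p ∨ (q < y ∧ y < r) ∨ s < y}
  have hS (y : ℕ) : y ∈ S ↔ y < p ∨ (q < y ∧ y < r) ∨ s < y := Iff.rfl
  have before_p : pathSet q r s (p - 1) = S := by
    ext y; simp only [pathSet, Set.mem_ofPred_eq, hS]; omega
  have after_p : pathSet q r s p = insert p S := by
    ext y; simp only [pathSet, Set.mem_ofPred_eq, Set.mem_insert_iff, hS]; omega
  have before_q : pathSet p r s (q - 1) = insert q S := by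
    ext y; simp only [pathSet, Set.mem_ofPred_eq, Set.mem_insert_iff, hS]; omega
  have after_q : pathSet p r s q = S := by
    ext y; simp only [pathSet, Set.mem_ofPred_eq, hS]; omega
  have before_r : pathSet p q s (r - 1) = S := by
    ext y; simp only [pathSet, Set.mem_ofPred_eq, hS]; omega
  have after_r : pathSet p q s r = insert r S := by
    ext y; simp only [pathSet, Set.mem_ofPred_eq, Set.mem_insert_iff, hS]; omega
  have before_s : pathSet p q r (s - 1) = insert s S := by
    ext y; simp only [pathSet, Set.mem_ofPred_eq, Set.mem_insert_iff, hS]; omega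
  have after_s : pathSet p q r s = S := by
    ext y; simp only [pathSet, Set.mem_ofPred_eq, hS]; omega
  simp only [pathEll, before_p, after_p, before_q, after_q, before_r, after_r, before_s, after_s]
  have not_mem_S {y : ℕ} (hy : ¬(y < p ∨ (q < y ∧ y < r) ∨ s < y)) : y ∉ S := hy
  linarith [hF.ell_tetrahedron hpos hp1 hpq hqr hrs hsn (not_mem_S (by omega))
    (not_mem_S (by omega)) (not_mem_S (by omega)) (not_mem_S (by omega))]

theorem sum_Icc_one_sub {M : Type*} [AddCommGroup M] (f : ℕ → M) (n : ℕ) :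
    ∑ m ∈ Finset.Icc 1 n, (f (m - 1) - f m) = f 0 - f n := by
  rw [← Finset.Ico_add_one_right_eq_Icc, Finset.sum_Ico_eq_sum_range]
  simpa only [Nat.add_sub_cancel, Nat.add_sub_cancel_left, add_comm 1] using
    Finset.sum_range_sub' f n

theorem ThreeTerm.sum_pathEll {n : ℕ} {F : Set ℕ → ℝ} (hF : ThreeTerm n F)
    (hpos : ∀ S, 0 < F S) :
    ∑ t ∈ T n, pathEll F t.1 t.2.1 t.2.2 0 = ∑ t ∈ T n, pathEll F t.1 t.2.1 t.2.2 n := by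
  suffices ∑ t ∈ T n, ∑ m ∈ Finset.Icc 1 n,
      (pathEll F t.1 t.2.1 t.2.2 (m - 1) - pathEll F t.1 t.2.1 t.2.2 m) = 0 by
    simp only [fun t : ℕ × ℕ × ℕ => sum_Icc_one_sub (pathEll F t.1 t.2.1 t.2.2) n] at this
    rwa [Finset.sum_sub_distrib, sub_eq_zero] at this
  rw [sum_T_sum_Icc n (fun a b c m => pathEll F a b c (m - 1) - pathEll F a b c m)
    fun a b c m hab hbc hm => by simp only [pathEll, pathSet_pred_of_mem hab hbc hm, sub_self]]
  refine Finset.sum_eq_zero fun p hp => Finset.sum_eq_zero fun q _ =>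
    Finset.sum_eq_zero fun r _ => Finset.sum_eq_zero fun s hs => ite_eq_right_iff.2 ?_
  rintro ⟨hpq, hqr, hrs⟩
  linarith [hF.pathEll_quadruple hpos (Finset.mem_Icc.1 hp).1 hpq hqr hrs (Finset.mem_Icc.1 hs).2]

section ConsDet

variable {R : Type*} [CommRing R] {m : ℕ}

open Matrix

/-- The determinant with first rows `x`, `y` followed by the rows of `A`: the Plücker coordinate
of the two remaining dimensions. -/
noncomputable def consDet (A : Fin m → Fin (m + 2) → R) (x y : Fin (m + 2) → R) : R :=
  detRowAlternating (vecCons x (vecCons y A))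

theorem consDet_swap (A : Fin m → Fin (m + 2) → R) (x y : Fin (m + 2) → R) :
    consDet A y x = -consDet A x y := by
  have h := detRowAlternating.map_insertNth 1 y (vecCons x A)
  rw [← Fin.succ_zero_eq_one, vecCons, vecCons, Fin.insertNth_succ_cons, Fin.insertNth_zero',
    Fin.val_succ, Fin.val_zero, zero_add, pow_one, neg_smul, one_smul] at h
  exact (neg_eq_iff_eq_neg.2 h).symm

theorem consDet_self_row (A : Fin m → Fin (m + 2) → R) (x : Fin (m + 2) → R) (i : Fin m) :
    consDet A x (A i) = 0 :=
  detRowAlternating.map_eq_zero_of_eq (i := 1) (j := i.succ.succ) _ rfl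
    ((Fin.succ_injective _).ne (Fin.succ_ne_zero i).symm)

-- By Cramer's rule `consDet A b c • a` is a combination of `b`, `c` and the rows of `A`;
-- substitute it into the second argument of `consDet A x`.
theorem consDet_threeTerm (A : Fin m → Fin (m + 2) → R) (x a b c : Fin (m + 2) → R) :
    consDet A x b * consDet A a c =
      consDet A x a * consDet A b c + consDet A x c * consDet A a b := by
  let M : Matrix (Fin (m + 2)) (Fin (m + 2)) R := of (vecCons b (vecCons c A))
  have update_zero : (M.updateRow 0 a).det = consDet A a c :=
    congrArg detRowAlternating (Fin.update_cons_zero (α := fun _ => Fin (m + 2) → R) _ _ _)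
  have update_one : (M.updateRow (Fin.succ 0) a).det = consDet A b a :=
    congrArg detRowAlternating <| (Fin.cons_update (α := fun _ => Fin (m + 2) → R) ..).symm.trans
      (congrArg (vecCons b) (Fin.update_cons_zero (α := fun _ => Fin (m + 2) → R) _ _ _))
  have cramer : consDet A b c • a =
      consDet A a c • b + (consDet A b a • c +
        ∑ i : Fin m, (M.updateRow i.succ.succ a).det • A i) := by
    have h := (Mᵀ.mulVec_cramer a).symm
    rw [mulVec_transpose, vecMul_eq_sum, det_transpose, Fin.sum_univ_succ, Fin.sum_univ_succ] at h
    simp only [cramer_transpose_apply, update_zero, update_one] at h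
    exact h
  let second : (Fin (m + 2) → R) →ₗ[R] R :=
    { toFun := consDet A x
      map_add' y z := congrArg (· A) (map_add (detRowAlternating.curryLeft x).curryLeft y z)
      map_smul' r y := congrArg (· A) (map_smul (detRowAlternating.curryLeft x).curryLeft r y) }
  have second_apply (y : Fin (m + 2) → R) : second y = consDet A x y := rfl
  have key := congrArg second cramer
  simp only [map_add, map_sum, map_smul] at key
  simp only [second_apply, consDet_self_row, mul_zero, Finset.sum_const_zero, add_zero,
    consDet_swap A a b, smul_eq_mul] at key
  linear_combination -key

theorem detRowAlternating_vecCons_single (A : Fin m → Fin (m + 1) → R) (p : Fin (m + 1)) :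
    detRowAlternating (vecCons (Pi.single p 1) A) =
      (-1) ^ (p : ℕ) * det (of fun i j => A i (p.succAbove j)) := by
  have expansion := det_succ_row_zero (of (vecCons (Pi.single p 1) A))
  rw [Finset.sum_eq_single p (fun j _ hj => by
      rw [of_apply, cons_val_zero, Pi.single_eq_of_ne hj, mul_zero, zero_mul])
    (fun hp => (hp (Finset.mem_univ p)).elim), of_apply, cons_val_zero, Pi.single_eq_same,
    mul_one] at expansion
  exact expansion

end ConsDet

section FlagMinor

variable {R : Type*} {α : Type*} [LinearOrder α]

/-- The column `x` of the matrix with rows `φ 0, …, φ (k - 1)`. -/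
def flagCol (φ : ℕ → α → R) (k : ℕ) (x : α) : Fin k → R := fun j => φ j x

theorem exists_orderEmbOfFin_insert {J : Finset α} {m : ℕ} (hm : J.card = m) {a : α}
    (hm' : (insert a J).card = m + 1) :
    ∃ p : Fin (m + 1), (p : ℕ) = (J.filter (· < a)).card ∧
      ⇑((insert a J).orderEmbOfFin hm') = p.insertNth (α := fun _ => α) a (J.orderEmbOfFin hm) := by
  set e := (insert a J).orderEmbOfFin hm'
  have mem_range (x : α) : x ∈ insert a J ↔ ∃ i, e i = x := by
    rw [← Finset.mem_coe, ← Finset.range_orderEmbOfFin _ hm', Set.mem_range]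
  obtain ⟨p, hp⟩ := (mem_range a).1 (Finset.mem_insert_self a J)
  have he : (fun i => e (p.succAbove i)) = J.orderEmbOfFin hm := by
    refine Finset.orderEmbOfFin_unique hm (fun i => ?_)
      (e.strictMono.comp (Fin.strictMono_succAbove p))
    refine (Finset.mem_insert.1 ((mem_range _).2 ⟨p.succAbove i, rfl⟩)).resolve_left fun h => ?_
    exact Fin.succAbove_ne p i (e.injective (h.trans hp.symm))
  refine ⟨p, ?_, he ▸ ((Fin.insertNth_eq_iff (α := fun _ => α)).2 ⟨hp.symm, rfl⟩).symm⟩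
  have hfilter : J.filter (· < a) = (Finset.Iio p).map e.toEmbedding := by
    ext x
    simp only [Finset.mem_filter, Finset.mem_map, Finset.mem_Iio, RelEmbedding.coe_toEmbedding]
    constructor
    · rintro ⟨hx, hxa⟩
      obtain ⟨i, rfl⟩ := (mem_range x).1 (Finset.mem_insert_of_mem hx)
      exact ⟨i, by rwa [← hp, e.lt_iff_lt] at hxa, rfl⟩
    · rintro ⟨i, hi, rfl⟩
      have hlt : e i < a := hp ▸ e.strictMono hi
      exact ⟨(Finset.mem_insert.1 ((mem_range _).2 ⟨i, rfl⟩)).resolve_left hlt.ne, hlt⟩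
  rw [hfilter, Finset.card_map, Fin.card_Iio]

theorem exists_flagCol_orderEmbOfFin_insert (φ : ℕ → α → R) (k : ℕ) {J : Finset α} {m : ℕ}
    (hm : J.card = m) {a : α} (hm' : (insert a J).card = m + 1) :
    ∃ p : Fin (m + 1), (p : ℕ) = (J.filter (· < a)).card ∧
      (fun i => flagCol φ k ((insert a J).orderEmbOfFin hm' i)) =
        p.insertNth (α := fun _ => Fin k → R) (flagCol φ k a)
          fun i => flagCol φ k (J.orderEmbOfFin hm i) := by
  obtain ⟨p, hp, he⟩ := exists_orderEmbOfFin_insert hm hm'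
  refine ⟨p, hp, ?_⟩
  rw [he]
  ext i j
  rcases Fin.eq_self_or_eq_succAbove p i with rfl | ⟨z, rfl⟩ <;>
    simp only [Fin.insertNth_apply_same, Fin.insertNth_apply_succAbove]

variable [CommRing R]

/-- The minor with columns `J` of the matrix with rows `φ 0, φ 1, …`, taken from the first `|J|`
rows. The sequence of rows is infinite so that one `φ` serves all sizes of `J`. -/
noncomputable def flagMinor (φ : ℕ → α → R) (J : Finset α) : R :=
  (Matrix.of fun i j : Fin J.card => φ i (J.orderEmbOfFin rfl j)).det

theorem flagMinor_eq_det_of_range_eq (φ : ℕ → α → R) {J : Finset α} {k : ℕ} {f : Fin k → α}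
    (hf : StrictMono f) (hJ : Set.range f = J) :
    flagMinor φ J = (Matrix.of fun i j : Fin k => φ i (f j)).det := by
  have hcard : J.card = k := by
    rw [← Set.ncard_coe_finset, ← hJ, ← Set.image_univ, Set.ncard_image_of_injective _ hf.injective,
      Set.ncard_univ, Nat.card_fin]
  subst hcard
  rw [Finset.orderEmbOfFin_unique rfl (fun i => Finset.mem_coe.1 (hJ ▸ ⟨i, rfl⟩)) hf]
  rfl

theorem flagMinor_eq_detRowAlternating (φ : ℕ → α → R) {J : Finset α} {k : ℕ} (h : J.card = k) :
    flagMinor φ J =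
      Matrix.detRowAlternating fun i : Fin k => flagCol φ k (J.orderEmbOfFin h i) := by
  subst h
  rw [flagMinor, ← Matrix.det_transpose]
  rfl

theorem flagMinor_insert (φ : ℕ → α → R) {J : Finset α} {m : ℕ} (h : J.card = m) {a : α}
    (ha : a ∉ J) :
    flagMinor φ (insert a J) = (-1) ^ (J.filter (· < a)).card *
      Matrix.detRowAlternating (Matrix.vecCons (flagCol φ (m + 1) a)
        fun i => flagCol φ (m + 1) (J.orderEmbOfFin h i)) := by
  have h' : (insert a J).card = m + 1 := by rw [Finset.card_insert_of_notMem ha, h]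
  obtain ⟨p, hp, hcols⟩ := exists_flagCol_orderEmbOfFin_insert φ (m + 1) h h'
  rw [flagMinor_eq_detRowAlternating φ h', hcols, AlternatingMap.map_insertNth, hp, zsmul_eq_mul,
    Int.cast_pow, Int.cast_neg, Int.cast_one]

theorem flagMinor_insert_insert (φ : ℕ → α → R) {J : Finset α} {m : ℕ} (h : J.card = m)
    {a b : α} (ha : a ∉ J) (hb : b ∉ J) (hab : a < b) :
    flagMinor φ (insert a (insert b J)) =
      (-1) ^ (J.filter (· < a)).card * (-1) ^ (J.filter (· < b)).card *
        consDet (fun i => flagCol φ (m + 2) (J.orderEmbOfFin h i)) (flagCol φ (m + 2) a)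
          (flagCol φ (m + 2) b) := by
  have h' : (insert b J).card = m + 1 := by rw [Finset.card_insert_of_notMem hb, h]
  have ha' : a ∉ insert b J := fun hmem => (Finset.mem_insert.1 hmem).elim hab.ne ha
  obtain ⟨p, hp, hcols⟩ := exists_flagCol_orderEmbOfFin_insert φ (m + 2) h h'
  rw [flagMinor_insert φ h' ha', Finset.filter_insert, if_neg hab.not_gt, hcols,
    ← AlternatingMap.curryLeft_apply_apply, AlternatingMap.map_insertNth, hp, zsmul_eq_mul,
    Int.cast_pow, Int.cast_neg, Int.cast_one, ← mul_assoc]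
  rfl

theorem flagMinor_omit_insert {φ ψ : ℕ → α → R} {S : Finset α} {m : ℕ} (h : S.card = m)
    {p : Fin (m + 2)} (hψ : ∀ (t : Fin (m + 1)) x, ψ t x = φ (p.succAbove t) x) {a : α}
    (ha : a ∉ S) :
    flagMinor ψ (insert a S) = (-1) ^ (S.filter (· < a)).card * ((-1) ^ (p : ℕ) *
      consDet (fun i => flagCol φ (m + 2) (S.orderEmbOfFin h i)) (Pi.single p 1)
        (flagCol φ (m + 2) a)) := by
  rw [flagMinor_insert ψ h ha, consDet, detRowAlternating_vecCons_single,
    ← mul_assoc ((-1) ^ (p : ℕ)), ← pow_add, Even.neg_one_pow ⟨_, rfl⟩, one_mul]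
  congr 2
  ext i j
  refine Fin.cases ?_ (fun i => ?_) i <;> exact hψ _ _

theorem flagMinor_threeTerm {φ ψ : ℕ → α → R} {S : Finset α} {m : ℕ} (hm : S.card = m)
    (p : Fin (m + 2)) (hψ : ∀ (t : Fin (m + 1)) x, ψ t x = φ (p.succAbove t) x) {a b c : α}
    (hab : a < b) (hbc : b < c) (ha : a ∉ S) (hb : b ∉ S) (hc : c ∉ S) :
    flagMinor ψ (insert b S) * flagMinor φ (insert a (insert c S)) =
      flagMinor ψ (insert a S) * flagMinor φ (insert b (insert c S)) +
        flagMinor ψ (insert c S) * flagMinor φ (insert a (insert b S)) := by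
  rw [flagMinor_omit_insert hm hψ ha, flagMinor_omit_insert hm hψ hb,
    flagMinor_omit_insert hm hψ hc, flagMinor_insert_insert φ hm ha hc (hab.trans hbc),
    flagMinor_insert_insert φ hm hb hc hbc, flagMinor_insert_insert φ hm ha hb hab]
  linear_combination ((-1) ^ (S.filter (· < a)).card * (-1) ^ (S.filter (· < b)).card *
    (-1) ^ (S.filter (· < c)).card * (-1) ^ (p : ℕ)) *
      consDet_threeTerm (fun i => flagCol φ (m + 2) (S.orderEmbOfFin hm i)) (Pi.single p 1)
        (flagCol φ (m + 2) a) (flagCol φ (m + 2) b) (flagCol φ (m + 2) c)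

theorem strictMono_append_orderEmbOfFin {I J : Finset α} (hIJ : ∀ x ∈ I, ∀ y ∈ J, x < y) :
    StrictMono (Fin.append (I.orderEmbOfFin rfl) (J.orderEmbOfFin rfl)) := by
  intro i j hij
  induction i using Fin.addCases with
  | left i =>
    rw [Fin.append_left]
    induction j using Fin.addCases with
    | left j =>
      rw [Fin.append_left]
      exact (I.orderEmbOfFin rfl).strictMono hij
    | right j =>
      rw [Fin.append_right]
      exact hIJ _ (I.orderEmbOfFin_mem rfl i) _ (J.orderEmbOfFin_mem rfl j)
  | right i =>
    induction j using Fin.addCases with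
    | left j => exact absurd ((Fin.lt_def.1 hij).trans j.isLt) (Nat.le_add_right _ _).not_gt
    | right j =>
      rw [Fin.append_right, Fin.append_right]
      exact (J.orderEmbOfFin rfl).strictMono ((Fin.natAdd_lt_natAdd_iff _).1 hij)

theorem range_append_orderEmbOfFin (I J : Finset α) :
    Set.range (Fin.append (I.orderEmbOfFin rfl) (J.orderEmbOfFin rfl)) = (I ∪ J : Finset α) := by
  rw [← (finSumFinEquiv (m := I.card) (n := J.card)).surjective.range_comp, Finset.coe_union,
    ← Finset.range_orderEmbOfFin I rfl, ← Finset.range_orderEmbOfFin J rfl, ← Set.Sum.elim_range,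
    ← Fin.append_comp_sumElim]
  exact congrArg (fun f => Set.range (_ ∘ f)) (funext fun x => by rcases x with i | i <;> rfl)

theorem flagMinor_union_of_lt {φ : ℕ → α → R} {I J : Finset α} (hIJ : ∀ x ∈ I, ∀ y ∈ J, x < y)
    (hφ : ∀ t, I.card ≤ t → ∀ x ∈ I, φ t x = 0) :
    flagMinor φ (I ∪ J) = flagMinor φ I * flagMinor (fun t => φ (I.card + t)) J := by
  let upperRight : Matrix (Fin I.card) (Fin J.card) R :=
    Matrix.of fun i j => φ i (J.orderEmbOfFin rfl j)
  rw [flagMinor_eq_det_of_range_eq φ (strictMono_append_orderEmbOfFin hIJ)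
      (range_append_orderEmbOfFin I J), ← Matrix.det_submatrix_equiv_self finSumFinEquiv, flagMinor,
    flagMinor, ← Matrix.det_fromBlocks_zero₂₁ _ upperRight]
  congr 1
  ext (i | i) (j | j)
  · simp
  · simp [upperRight]
  · simp [hφ]
  · simp

end FlagMinor

section FlagMinorsOfMatrices

variable {n : ℕ}

theorem mem_seg {a b : ℕ} {x : Fin n} : x ∈ seg n a b ↔ a ≤ (x : ℕ) + 1 ∧ (x : ℕ) + 1 ≤ b := by
  simp only [seg, Finset.mem_filter, Finset.mem_univ, true_and]

theorem mem_bar {I : Finset (Fin n)} {x : Fin n} : x ∈ bar I ↔ x.rev ∈ I := by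
  simp only [bar, Finset.mem_image]
  exact ⟨fun ⟨y, hy, hyx⟩ => by rwa [← hyx, Fin.rev_rev], fun h => ⟨_, h, Fin.rev_rev x⟩⟩

theorem bar_bar (I : Finset (Fin n)) : bar (bar I) = I := by
  ext x
  rw [mem_bar, mem_bar, Fin.rev_rev]

theorem bar_insert (a : Fin n) (I : Finset (Fin n)) : bar (insert a I) = insert a.rev (bar I) :=
  Finset.image_insert _ _ _

theorem bar_seg (a b : ℕ) : bar (seg n a b) = seg n (n + 1 - b) (n + 1 - a) := by
  ext x
  simp only [mem_bar, mem_seg, Fin.val_rev]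
  omega

theorem bar_union (I J : Finset (Fin n)) : bar (I ∪ J) = bar I ∪ bar J :=
  Finset.image_union _ _

/-- The rows of a matrix as a sequence of functions, continued by zero. -/
noncomputable def rowFn (G : Matrix (Fin n) (Fin n) ℝ) (t : ℕ) (x : Fin n) : ℝ :=
  if h : t < n then G ⟨t, h⟩ x else 0

theorem rowFn_of_lt (G : Matrix (Fin n) (Fin n) ℝ) {t : ℕ} (ht : t < n) :
    rowFn G t = G ⟨t, ht⟩ :=
  funext fun _ => dif_pos ht

theorem rowFn_eq_zero {G : Matrix (Fin n) (Fin n) ℝ} (hG : G.IsUpperTriangular) {t : ℕ}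
    {x : Fin n} (hx : (x : ℕ) < t) : rowFn G t x = 0 := by
  rw [rowFn]
  split_ifs with ht
  · exact hG (Fin.lt_def.2 hx)
  · rfl

/-- The reflection of a matrix in its antidiagonal. -/
def antitranspose (G : Matrix (Fin n) (Fin n) ℝ) : Matrix (Fin n) (Fin n) ℝ :=
  G.transpose.submatrix Fin.rev Fin.rev

theorem antitranspose_antitranspose (G : Matrix (Fin n) (Fin n) ℝ) :
    antitranspose (antitranspose G) = G := by
  ext i j
  simp only [antitranspose, Matrix.submatrix_apply, Matrix.transpose_apply, Fin.rev_rev]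

theorem det_antitranspose (G : Matrix (Fin n) (Fin n) ℝ) : (antitranspose G).det = G.det :=
  (Matrix.det_submatrix_equiv_self Fin.revPerm G.transpose).trans G.det_transpose

theorem upperMinor_eq_flagMinor (G : Matrix (Fin n) (Fin n) ℝ) (J : Finset (Fin n)) :
    upperMinor G J = flagMinor (rowFn G) J := by
  unfold upperMinor flagMinor
  congr 1
  ext i j
  exact (congrFun (rowFn_of_lt G _) _).symm

theorem strictMono_rev_comp_rev {k : ℕ} {f : Fin k → Fin n} (hf : StrictMono f) :
    StrictMono fun i : Fin k => (f i.rev).rev :=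
  fun _ _ hij => Fin.rev_lt_rev.2 (hf (Fin.rev_lt_rev.2 hij))

theorem range_rev_orderEmbOfFin_rev (I : Finset (Fin n)) :
    Set.range (fun i : Fin I.card => (I.orderEmbOfFin rfl i.rev).rev) = bar I := by
  rw [bar, Finset.coe_image, ← Finset.range_orderEmbOfFin I rfl, ← Set.range_comp]
  exact Fin.rev_surjective.range_comp fun i => (I.orderEmbOfFin rfl i).rev

theorem upperMinor_bar (G : Matrix (Fin n) (Fin n) ℝ) (I : Finset (Fin n)) :
    upperMinor G (bar I) =
      (Matrix.of fun i j : Fin I.card => rowFn G i (I.orderEmbOfFin rfl j.rev).rev).det := by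
  rw [upperMinor_eq_flagMinor, flagMinor_eq_det_of_range_eq _
    (strictMono_rev_comp_rev (I.orderEmbOfFin rfl).strictMono) (range_rev_orderEmbOfFin_rev I)]

theorem rightMinor_eq_upperMinor_antitranspose (G : Matrix (Fin n) (Fin n) ℝ)
    (I : Finset (Fin n)) : rightMinor G I = upperMinor (antitranspose G) (bar I) := by
  have hcard : I.card ≤ n := (I.card_le_univ).trans_eq (Fintype.card_fin n)
  rw [upperMinor_bar, rightMinor, ← Matrix.det_transpose,
    ← Matrix.det_submatrix_equiv_self Fin.revPerm]
  congr 1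
  ext i j
  simp only [Matrix.submatrix_apply, Matrix.transpose_apply, Matrix.of_apply, Fin.revPerm_apply,
    rowFn_of_lt _ (i.2.trans_le hcard), antitranspose, Fin.rev_rev]
  congr 1
  simp only [Fin.ext_iff, Fin.val_rev]
  omega

theorem upperMinor_univ (G : Matrix (Fin n) (Fin n) ℝ) : upperMinor G Finset.univ = G.det := by
  rw [upperMinor_eq_flagMinor,
    flagMinor_eq_det_of_range_eq _ strictMono_id (Set.range_id.trans Finset.coe_univ.symm)]
  congr 1
  ext i j
  exact congrFun (rowFn_of_lt G i.2) j

theorem upperMinor_threeTerm (G : Matrix (Fin n) (Fin n) ℝ) {S : Finset (Fin n)} {a b c : Fin n}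
    (hab : a < b) (hbc : b < c) (ha : a ∉ S) (hb : b ∉ S) (hc : c ∉ S) :
    upperMinor G (insert b S) * upperMinor G (insert a (insert c S)) =
      upperMinor G (insert a S) * upperMinor G (insert b (insert c S)) +
        upperMinor G (insert c S) * upperMinor G (insert a (insert b S)) := by
  simp only [upperMinor_eq_flagMinor]
  refine flagMinor_threeTerm rfl (Fin.last _) (fun t x => ?_) hab hbc ha hb hc
  rw [Fin.succAbove_last, Fin.val_castSucc]

theorem rightMinor_threeTerm (G : Matrix (Fin n) (Fin n) ℝ) {S : Finset (Fin n)} {a b c : Fin n}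
    (hab : a < b) (hbc : b < c) (ha : a ∉ S) (hb : b ∉ S) (hc : c ∉ S) :
    rightMinor G (insert b S) * rightMinor G (insert a (insert c S)) =
      rightMinor G (insert a S) * rightMinor G (insert b (insert c S)) +
        rightMinor G (insert c S) * rightMinor G (insert a (insert b S)) := by
  have rev_not_mem {x : Fin n} (hx : x ∉ S) : x.rev ∉ bar S := by rwa [mem_bar, Fin.rev_rev]
  have reflected := upperMinor_threeTerm (antitranspose G) (Fin.rev_lt_rev.2 hbc)
    (Fin.rev_lt_rev.2 hab) (rev_not_mem hc) (rev_not_mem hb) (rev_not_mem ha)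
  simp only [rightMinor_eq_upperMinor_antitranspose, bar_insert]
  rw [Finset.insert_comm a.rev c.rev, Finset.insert_comm b.rev c.rev,
    Finset.insert_comm a.rev b.rev]
  linear_combination reflected

/-- The set of zero-based indices whose one-based labels lie in `P`. -/
noncomputable def idxSet (n : ℕ) (P : Set ℕ) : Finset (Fin n) :=
  open Classical in Finset.univ.filter fun i : Fin n => (i : ℕ) + 1 ∈ P

theorem mem_idxSet {P : Set ℕ} {x : Fin n} : x ∈ idxSet n P ↔ (x : ℕ) + 1 ∈ P := by
  simp only [idxSet, Finset.mem_filter, Finset.mem_univ, true_and]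

theorem idxSet_insert {P : Set ℕ} (x : Fin n) :
    idxSet n (insert ((x : ℕ) + 1) P) = insert x (idxSet n P) := by
  ext y
  simp only [mem_idxSet, Finset.mem_insert, Set.mem_insert_iff, Fin.ext_iff, add_left_inj]

theorem threeTerm_comp_idxSet {F : Finset (Fin n) → ℝ}
    (hF : ∀ {S : Finset (Fin n)} {a b c : Fin n}, a < b → b < c → a ∉ S → b ∉ S → c ∉ S →
      F (insert b S) * F (insert a (insert c S)) =
        F (insert a S) * F (insert b (insert c S)) + F (insert c S) * F (insert a (insert b S))) :
    ThreeTerm n fun P => F (idxSet n P) := by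
  intro S a b c ha hab hbc hc haS hbS hcS
  have exists_index {x : ℕ} (hx : 1 ≤ x) (hxn : x ≤ n) : ∃ i : Fin n, x = (i : ℕ) + 1 :=
    ⟨⟨x - 1, by omega⟩, (Nat.sub_add_cancel hx).symm⟩
  obtain ⟨a, rfl⟩ := exists_index ha (by omega)
  obtain ⟨b, rfl⟩ := exists_index (x := b) (by omega) (by omega)
  obtain ⟨c, rfl⟩ := exists_index (x := c) (by omega) hc
  simp only [idxSet_insert]
  exact hF (by omega) (by omega) (mt mem_idxSet.1 haS) (mt mem_idxSet.1 hbS)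
    (mt mem_idxSet.1 hcS)

section Ratios

variable (G : Matrix (Fin n) (Fin n) ℝ) {a b c : ℕ}

theorem Ylow_eq_exchangeRatio (ha : 1 ≤ a) (hab : a < b) (hbc : b < c) :
    Ylow G a b c =
      exchangeRatio (fun P => rightMinor G (idxSet n P)) (pathSet a b c 0) a b c := by
  unfold Ylow exchangeRatio
  congr 3 <;> ext x <;> have := x.2 <;>
    simp only [Finset.mem_union, mem_seg, mem_idxSet, Set.mem_insert_iff, pathSet,
      Set.mem_ofPred_eq] <;> omega

theorem Ytlow_eq_exchangeRatio (ha : 1 ≤ a) (hab : a < b) (hbc : b < c) :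
    Ytlow G a b c =
      exchangeRatio (fun P => rightMinor G (idxSet n P)) (pathSet a b c n) a b c := by
  unfold Ytlow exchangeRatio
  congr 3 <;> ext x <;> have := x.2 <;>
    simp only [Finset.mem_union, mem_seg, mem_idxSet, Set.mem_insert_iff, pathSet,
      Set.mem_ofPred_eq] <;> omega

theorem one_div_Yup_eq_exchangeRatio (ha : 1 ≤ a) (hab : a < b) (hbc : b < c) :
    1 / Yup G a b c =
      exchangeRatio (fun P => upperMinor G (idxSet n P)) (pathSet a b c 0) a b c := by
  unfold Yup exchangeRatio
  rw [one_div_div]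
  congr 3 <;> ext x <;> have := x.2 <;>
    simp only [Finset.mem_union, mem_seg, mem_idxSet, Set.mem_insert_iff, pathSet,
      Set.mem_ofPred_eq] <;> omega

theorem one_div_Ytup_eq_exchangeRatio (ha : 1 ≤ a) (hab : a < b) (hbc : b < c) :
    1 / Ytup G a b c =
      exchangeRatio (fun P => upperMinor G (idxSet n P)) (pathSet a b c n) a b c := by
  unfold Ytup exchangeRatio
  rw [one_div_div]
  congr 3 <;> ext x <;> have := x.2 <;>
    simp only [Finset.mem_union, mem_seg, mem_idxSet, Set.mem_insert_iff, pathSet,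
      Set.mem_ofPred_eq] <;> omega

end Ratios

end FlagMinorsOfMatrices

section SolidMinors

variable {n : ℕ}

theorem range_seg {a k : ℕ} (h : a + k ≤ n) :
    Set.range (fun i : Fin k => (⟨a + i, by omega⟩ : Fin n)) = seg n (a + 1) (a + k) := by
  ext x
  simp only [Set.mem_range, Finset.mem_coe, mem_seg, Fin.ext_iff]
  exact ⟨fun ⟨i, hi⟩ => by omega, fun hx => ⟨⟨x - a, by omega⟩, by simp only; omega⟩⟩

theorem strictMono_addLeft_mk {a k : ℕ} (h : a + k ≤ n) :
    StrictMono fun i : Fin k => (⟨a + i, by omega⟩ : Fin n) :=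
  fun _ _ hij => Nat.add_lt_add_left (Fin.lt_def.1 hij) a

theorem card_seg {a k : ℕ} (h : a + k ≤ n) : (seg n (a + 1) (a + k)).card = k := by
  rw [← Set.ncard_coe_finset, ← range_seg h, ← Set.image_univ,
    Set.ncard_image_of_injective _ (strictMono_addLeft_mk h).injective, Set.ncard_univ,
    Nat.card_fin]

theorem card_seg_one {a : ℕ} (h : a ≤ n) : (seg n 1 a).card = a := by
  simpa only [zero_add] using card_seg (n := n) (a := 0) (k := a) (by omega)

theorem flagMinor_seg (φ : ℕ → Fin n → ℝ) {a k : ℕ} (h : a + k ≤ n) :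
    flagMinor φ (seg n (a + 1) (a + k)) =
      (Matrix.of fun i j : Fin k => φ i ⟨a + j, by omega⟩).det :=
  flagMinor_eq_det_of_range_eq φ (strictMono_addLeft_mk h) (range_seg h)

/-- The `k × k` minor of consecutive rows and columns starting at the zero-based position
`(r, c)`. -/
noncomputable def solidMinor (G : Matrix (Fin n) (Fin n) ℝ) (r c k : ℕ) : ℝ :=
  flagMinor (fun t => rowFn G (r + t)) (seg n (c + 1) (c + k))

theorem solidMinor_antitranspose (G : Matrix (Fin n) (Fin n) ℝ) {r c k : ℕ} (hr : r + k ≤ n)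
    (hc : c + k ≤ n) :
    solidMinor (antitranspose G) r c k = solidMinor G (n - (c + k)) (n - (r + k)) k := by
  rw [solidMinor, solidMinor, flagMinor_seg _ hc, flagMinor_seg _ (by omega),
    ← Matrix.det_transpose, ← Matrix.det_submatrix_equiv_self Fin.revPerm]
  congr 1
  ext i j
  simp only [Matrix.submatrix_apply, Matrix.transpose_apply, Matrix.of_apply, Fin.revPerm_apply]
  rw [rowFn_of_lt _ (by omega), rowFn_of_lt _ (by omega), antitranspose, Matrix.submatrix_apply,
    Matrix.transpose_apply]
  congr 1 <;> simp only [Fin.ext_iff, Fin.val_rev] <;> omega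

variable {G : Matrix (Fin n) (Fin n) ℝ}

theorem isUpperTriangular_of_mem_B (hG : G ∈ B n) : G.IsUpperTriangular :=
  fun i j hij => hG.1 i j hij

theorem upperMinor_seg_union (hG : G.IsUpperTriangular) {a : ℕ} (ha : a ≤ n)
    {J : Finset (Fin n)} (hJ : ∀ x ∈ J, a ≤ (x : ℕ)) :
    upperMinor G (seg n 1 a ∪ J) =
      upperMinor G (seg n 1 a) * flagMinor (fun t => rowFn G (a + t)) J := by
  rw [upperMinor_eq_flagMinor, upperMinor_eq_flagMinor, flagMinor_union_of_lt, card_seg_one ha]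
  · intro x hx y hy
    exact Fin.lt_def.2 ((mem_seg.1 hx).2.trans (hJ y hy))
  · intro t ht x hx
    rw [card_seg_one ha] at ht
    exact rowFn_eq_zero hG ((mem_seg.1 hx).2.trans ht)

theorem upperMinor_seg_union_seg (hG : G.IsUpperTriangular) {a b c : ℕ} (hab : a < b)
    (ha : a ≤ n) (hbc : b ≤ c + 1) :
    upperMinor G (seg n 1 a ∪ seg n b c) =
      upperMinor G (seg n 1 a) * solidMinor G a (b - 1) (c + 1 - b) := by
  rw [upperMinor_seg_union hG ha fun x hx => by have := mem_seg.1 hx; omega, solidMinor,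
    Nat.sub_add_cancel (by omega), show b - 1 + (c + 1 - b) = c by omega]

theorem isUpperTriangular_antitranspose (hG : G.IsUpperTriangular) :
    (antitranspose G).IsUpperTriangular :=
  fun _ _ hij => hG (Fin.rev_lt_rev.2 hij)

theorem rightMinor_seg_union_seg (hG : G.IsUpperTriangular) {a b c : ℕ} (ha : 1 ≤ a)
    (hab : a ≤ b + 1) (hbc : b < c) (hc : c ≤ n + 1) :
    rightMinor G (seg n a b ∪ seg n c n) =
      rightMinor G (seg n c n) * solidMinor G (a - 1) (c + a - b - 2) (b + 1 - a) := by
  rw [rightMinor_eq_upperMinor_antitranspose, rightMinor_eq_upperMinor_antitranspose, bar_union,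
    Finset.union_comm, bar_seg, bar_seg, Nat.add_sub_cancel_left,
    upperMinor_seg_union_seg (isUpperTriangular_antitranspose hG) (by omega) (by omega) (by omega),
    solidMinor_antitranspose G (by omega) (by omega)]
  congr 2 <;> omega

theorem upperMinor_seg_one_ne_zero (hG : G ∈ B n) {a : ℕ} (ha : a ≤ n) :
    upperMinor G (seg n 1 a) ≠ 0 := by
  have huniv : seg n 1 a ∪ seg n (a + 1) n = Finset.univ := by
    ext x
    simp only [Finset.mem_union, mem_seg, Finset.mem_univ, iff_true]
    omega
  have hdet := ((Matrix.isUnit_iff_isUnit_det G).1 hG.2).ne_zero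
  rw [← upperMinor_univ, ← huniv, upperMinor_seg_union_seg (isUpperTriangular_of_mem_B hG)
    (Nat.lt_succ_self a) ha (by omega)] at hdet
  exact left_ne_zero_of_mul hdet

theorem antitranspose_mem_B (hG : G ∈ B n) : antitranspose G ∈ B n := by
  refine ⟨fun i j hij => isUpperTriangular_antitranspose (isUpperTriangular_of_mem_B hG) hij, ?_⟩
  rw [Matrix.isUnit_iff_isUnit_det, det_antitranspose]
  exact (Matrix.isUnit_iff_isUnit_det G).1 hG.2

theorem rightMinor_seg_ne_zero (hG : G ∈ B n) {c : ℕ} (hc : 1 ≤ c) :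
    rightMinor G (seg n c n) ≠ 0 := by
  rw [rightMinor_eq_upperMinor_antitranspose, bar_seg, Nat.add_sub_cancel_left]
  exact upperMinor_seg_one_ne_zero (antitranspose_mem_B hG) (by omega)

theorem Ylow_eq_Ytup (hG : G ∈ B n) {a b c : ℕ} (ha : 1 ≤ a) (hab : a < b) (hbc : b < c)
    (hc : c ≤ n) : Ylow G a b c = Ytup G a (a + c - b) c := by
  have hU := isUpperTriangular_of_mem_B hG
  have cancel {p q : ℝ} (hp : p ≠ 0) (hq : q ≠ 0) (w x y z : ℝ) :
      p * w * (q * x) / (p * y * (q * z)) = w * x / (y * z) := by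
    rw [mul_mul_mul_comm, mul_mul_mul_comm p y, mul_div_mul_left _ _ (mul_ne_zero hp hq)]
  unfold Ylow Ytup
  rw [rightMinor_seg_union_seg hU ha (by omega) (by omega) (by omega),
    rightMinor_seg_union_seg hU (by omega) (by omega) (by omega) (by omega),
    rightMinor_seg_union_seg hU ha (by omega) (by omega) (by omega),
    rightMinor_seg_union_seg hU (by omega) (by omega) (by omega) (by omega),
    upperMinor_seg_union_seg hU (by omega) (by omega) (by omega),
    upperMinor_seg_union_seg hU (by omega) (by omega) (by omega),
    upperMinor_seg_union_seg hU (by omega) (by omega) (by omega),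
    upperMinor_seg_union_seg hU (by omega) (by omega) (by omega),
    cancel (rightMinor_seg_ne_zero hG (by omega)) (rightMinor_seg_ne_zero hG (by omega)),
    cancel (upperMinor_seg_one_ne_zero hG (by omega)) (upperMinor_seg_one_ne_zero hG (by omega)),
    mul_comm (solidMinor G (a - 1) _ _)]
  congr 1
  · congr 2 <;> omega
  · rw [mul_comm]
    congr 2 <;> omega

end SolidMinors

section PositiveFlagMinors

variable {n k : ℕ}

theorem exists_mem_B_det_ne_zero (r c : Fin k ↪o Fin n) (h : ∀ i, r i ≤ c i) :
    ∃ H ∈ B n, (H.submatrix r c).det ≠ 0 := by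
  classical
  let H : Matrix (Fin n) (Fin n) ℝ :=
    Matrix.of fun i j => if i = j ∨ ∃ t, r t = i ∧ c t = j then 1 else 0
  have hH : H.IsUpperTriangular := fun i j (hij : j < i) => by
    refine if_neg ?_
    rintro (rfl | ⟨t, rfl, rfl⟩)
    · exact hij.false
    · exact (h t).not_gt hij
  have hsub : (H.submatrix r c).IsLowerTriangular := fun i j (hij : i < j) => by
    refine if_neg ?_
    rintro (hrc | ⟨t, hr, hc⟩)
    · exact ((h i).trans_lt (c.strictMono hij)).ne hrc
    · exact hij.ne ((r.injective hr).symm.trans (c.injective hc))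
  refine ⟨H, ⟨fun i j hij => hH hij, ?_⟩, ?_⟩
  · rw [Matrix.isUnit_iff_isUnit_det, Matrix.det_of_isUpperTriangular hH]
    simp [H]
  · rw [Matrix.det_of_isLowerTriangular _ hsub]
    simp [H]

theorem val_le_val_of_strictMono {f : Fin k → Fin n} (hf : StrictMono f) (i : Fin k) :
    (i : ℕ) ≤ f i := by
  rw [← Fin.card_Iio i, ← Fin.card_Iio (f i)]
  exact Finset.card_le_card_of_injOn f
    (fun j hj => Finset.mem_coe.2 (Finset.mem_Iio.2 (hf (Finset.mem_Iio.1 hj))))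
    hf.injective.injOn

theorem val_le_sub_add_of_strictMono {f : Fin k → Fin n} (hf : StrictMono f) (i : Fin k) :
    (f i : ℕ) ≤ n - k + i := by
  have hrev := val_le_val_of_strictMono (strictMono_rev_comp_rev hf) i.rev
  rw [Fin.rev_rev, Fin.val_rev, Fin.val_rev] at hrev
  omega

variable {G : Matrix (Fin n) (Fin n) ℝ}

theorem upperMinor_pos (hG : G ∈ BPlus n) (J : Finset (Fin n)) : 0 < upperMinor G J :=
  have hcard : J.card ≤ n := J.card_le_univ.trans_eq (Fintype.card_fin n)
  hG.2 _ (Fin.castLEOrderEmb hcard) (J.orderEmbOfFin rfl) <|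
    exists_mem_B_det_ne_zero _ _ fun i =>
      val_le_val_of_strictMono (J.orderEmbOfFin rfl).strictMono i

theorem rightMinor_pos (hG : G ∈ BPlus n) (I : Finset (Fin n)) : 0 < rightMinor G I :=
  have hcard : I.card ≤ n := I.card_le_univ.trans_eq (Fintype.card_fin n)
  hG.2 _ (I.orderEmbOfFin rfl)
    (OrderEmbedding.ofStrictMono (fun j : Fin I.card => ⟨n - I.card + j, by omega⟩)
      fun _ _ hij => Nat.add_lt_add_left hij _) <|
    exists_mem_B_det_ne_zero _ _ fun i =>
      val_le_sub_add_of_strictMono (I.orderEmbOfFin rfl).strictMono i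

end PositiveFlagMinors

section Criterion

variable {n k : ℕ} {H : Matrix (Fin n) (Fin n) ℝ} {c : ℕ → ℕ}

/-- The columns of `H` with zero-based labels `c 0, c 1, …`, a column being zero if its label is
at least `n`. Thus `flagMinor (colFn H c) I` is the minor of `H` with rows `I` and columns
`c 0, …, c (|I| - 1)`. -/
noncomputable def colFn (H : Matrix (Fin n) (Fin n) ℝ) (c : ℕ → ℕ) (t : ℕ) : Fin n → ℝ :=
  rowFn H.transpose (c t)

/-- For each `t`, the element of `I` with exactly `t` predecessors in `I` is at most `c t`: these
are the pairs of row and column sets whose minor does not vanish identically on `B n`. -/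
def Dominated (c : ℕ → ℕ) (I : Finset (Fin n)) : Prop :=
  ∀ t < I.card, t < (I.filter fun i : Fin n => (i : ℕ) ≤ c t).card

theorem colFn_eq_zero (hH : H.IsUpperTriangular) {t : ℕ} {x : Fin n} (hx : c t < x) :
    colFn H c t x = 0 := by
  rw [colFn, rowFn]
  split_ifs
  · exact hH (Fin.lt_def.2 hx)
  · rfl

theorem det_submatrix_eq_flagMinor_colFn (H : Matrix (Fin n) (Fin n) ℝ) {I : Finset (Fin n)}
    {f : Fin k → Fin n} (hf : StrictMono f) (hI : Set.range f = I) {g : Fin k → Fin n}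
    (hg : ∀ i : Fin k, c i = g i) : (H.submatrix f g).det = flagMinor (colFn H c) I := by
  rw [flagMinor_eq_det_of_range_eq _ hf hI, ← Matrix.det_transpose]
  congr 1
  ext i j
  have hi : c i < n := (hg i).trans_lt (g i).2
  simp only [Matrix.transpose_apply, Matrix.submatrix_apply, Matrix.of_apply, colFn,
    rowFn_of_lt _ hi]
  exact congrArg _ (Fin.ext (hg i).symm)

theorem dominated_of_flagMinor_ne_zero (hH : H.IsUpperTriangular) {I : Finset (Fin n)}
    (hc : MonotoneOn c (Set.Iio I.card)) (hI : flagMinor (colFn H c) I ≠ 0) : Dominated c I := by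
  intro t ht
  rw [flagMinor, Matrix.det_apply] at hI
  obtain ⟨σ, -, hσ⟩ := Finset.exists_ne_zero_of_sum_ne_zero hI
  have le_col (i : Fin I.card) : (I.orderEmbOfFin rfl i : ℕ) ≤ c (σ i) := by
    by_contra! hi
    refine hσ ?_
    rw [Finset.prod_eq_zero (Finset.mem_univ i) (colFn_eq_zero hH hi), smul_zero]
  rw [← Nat.succ_le_iff, Nat.succ_eq_add_one, ← Fin.card_Iic ⟨t, ht⟩]
  refine Finset.card_le_card_of_injOn (fun s => I.orderEmbOfFin rfl (σ.symm s)) (fun s hs => ?_)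
    ((I.orderEmbOfFin rfl).injective.comp σ.symm.injective).injOn
  have hst : s ≤ ⟨t, ht⟩ := Finset.mem_Iic.1 (Finset.mem_coe.1 hs)
  have hcol := le_col (σ.symm s)
  rw [Equiv.apply_symm_apply] at hcol
  exact Finset.mem_coe.2 (Finset.mem_filter.2
    ⟨Finset.orderEmbOfFin_mem _ _ _, hcol.trans (hc s.2 ht hst)⟩)

theorem card_insert_insert {S : Finset (Fin n)} {a b : Fin n} (hab : a ≠ b) (ha : a ∉ S)
    (hb : b ∉ S) : (insert a (insert b S)).card = S.card + 1 + 1 := by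
  rw [Finset.card_insert_of_notMem (mt Finset.mem_insert.1 (not_or.2 ⟨hab, ha⟩)),
    Finset.card_insert_of_notMem hb]

theorem card_filter_insert {S : Finset (Fin n)} {a : Fin n} (ha : a ∉ S) (x : ℕ) :
    ((insert a S).filter fun i : Fin n => (i : ℕ) ≤ x).card =
      (S.filter fun i : Fin n => (i : ℕ) ≤ x).card + if (a : ℕ) ≤ x then 1 else 0 := by
  rw [Finset.filter_insert]
  split_ifs
  · exact Finset.card_insert_of_notMem fun h => ha (Finset.mem_of_mem_filter _ h)
  · rfl

theorem Dominated.insert_of_le {J : Finset (Fin n)} {g b : Fin n} (hd : Dominated c (insert b J))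
    (hgb : g ≤ b) (hg : g ∉ J) (hb : b ∉ J) : Dominated c (insert g J) := by
  intro t ht
  rw [Finset.card_insert_of_notMem hg] at ht
  have hlt := hd t (by rwa [Finset.card_insert_of_notMem hb])
  rw [card_filter_insert hb] at hlt
  rw [card_filter_insert hg]
  split_ifs at hlt ⊢ <;> omega

theorem Dominated.tail_insert {S : Finset (Fin n)} {a b z : Fin n}
    (hd : Dominated c (insert a (insert b S))) (hS : ∀ x ∈ S, x ≤ b) (hzb : z ≤ b)
    (hab : a ≠ b) (ha : a ∉ S) (hb : b ∉ S) (hz : z ∉ S) :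
    Dominated (fun t => c (t + 1)) (insert z S) := by
  intro t ht
  rw [Finset.card_insert_of_notMem hz] at ht
  by_cases hbt : (b : ℕ) ≤ c (t + 1)
  · rw [Finset.filter_true_of_mem fun x hx => ?_, Finset.card_insert_of_notMem hz]
    · exact ht
    · rcases Finset.mem_insert.1 hx with rfl | hx
      exacts [(Fin.le_def.1 hzb).trans hbt, (Fin.le_def.1 (hS x hx)).trans hbt]
  · have hlt := hd (t + 1) (by rw [card_insert_insert hab ha hb]; omega)
    rw [card_filter_insert (mt Finset.mem_insert.1 (not_or.2 ⟨hab, ha⟩)),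
      card_filter_insert hb, if_neg hbt] at hlt
    have htS : t < (S.filter fun i : Fin n => (i : ℕ) ≤ c (t + 1)).card := by
      split_ifs at hlt <;> omega
    exact htS.trans_le
      (Finset.card_le_card (Finset.filter_subset_filter _ (Finset.subset_insert z S)))

theorem Dominated.le_of_seg {a t : ℕ} (hak : a + k ≤ n) (hd : Dominated c (seg n (a + 1) (a + k)))
    (hc : MonotoneOn c (Set.Iio k)) (ht : t < k) : a ≤ c t := by
  obtain ⟨x, hx⟩ := Finset.card_pos.1 (hd 0 (by rw [card_seg hak]; omega))
  rw [Finset.mem_filter, mem_seg] at hx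
  have h0t : c 0 ≤ c t := hc (t.zero_le.trans_lt ht) ht t.zero_le
  omega

theorem eq_seg_or_exists_gap (I : Finset (Fin n)) :
    (∃ a k, a + k ≤ n ∧ I = seg n (a + 1) (a + k)) ∨
      ∃ (S : Finset (Fin n)) (a g b : Fin n), a < g ∧ g < b ∧ g ∉ S ∧ (∀ x ∈ S, a < x ∧ x < b) ∧
        I = insert a (insert b S) := by
  rcases I.eq_empty_or_nonempty with rfl | hI
  · refine Or.inl ⟨0, 0, Nat.zero_le n, Finset.ext fun x => ?_⟩
    simp only [mem_seg, Finset.notMem_empty, false_iff]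
    omega
  set a := I.min' hI
  set b := I.max' hI
  have ha : a ∈ I := I.min'_mem hI
  have hb : b ∈ I := I.max'_mem hI
  have bounds {x : Fin n} (hx : x ∈ I) : a ≤ x ∧ x ≤ b := ⟨I.min'_le x hx, I.le_max' x hx⟩
  by_cases hgap : ∃ g, a ≤ g ∧ g ≤ b ∧ g ∉ I
  · obtain ⟨g, hag, hgb, hg⟩ := hgap
    have hag : a < g := hag.lt_of_ne fun h => hg (h ▸ ha)
    have hgb : g < b := hgb.lt_of_ne fun h => hg (h ▸ hb)
    refine Or.inr ⟨(I.erase a).erase b, a, g, b, hag, hgb, ?_, fun x hx => ?_, ?_⟩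
    · exact fun h => hg (Finset.mem_of_mem_erase (Finset.mem_of_mem_erase h))
    · rw [Finset.mem_erase, Finset.mem_erase] at hx
      exact ⟨(bounds hx.2.2).1.lt_of_ne hx.2.1.symm, (bounds hx.2.2).2.lt_of_ne hx.1⟩
    · rw [Finset.insert_erase (Finset.mem_erase.2 ⟨(hag.trans hgb).ne', hb⟩),
        Finset.insert_erase ha]
  · push Not at hgap
    have hab : (a : ℕ) ≤ b := Fin.le_def.1 (bounds ha).2
    refine Or.inl ⟨a, b + 1 - a, by omega, Finset.ext fun x => ?_⟩
    rw [mem_seg]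
    refine ⟨fun hx => ?_, fun hx => hgap x (Fin.le_def.2 (by omega)) (Fin.le_def.2 (by omega))⟩
    have hax := Fin.le_def.1 (bounds hx).1
    have hxb := Fin.le_def.1 (bounds hx).2
    omega

theorem flagMinor_colFn_seg_pos (hH : H.IsUpperTriangular) (hpos : ∀ J, 0 < upperMinor H J)
    {a : ℕ} (hak : a + k ≤ n) (hc : StrictMonoOn c (Set.Iio k))
    (hcn : Set.MapsTo c (Set.Iio k) (Set.Iio n)) (hac : ∀ t < k, a ≤ c t) :
    0 < flagMinor (colFn H c) (seg n (a + 1) (a + k)) := by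
  let f : Fin k → Fin n := fun t => ⟨c t, hcn t.2⟩
  have hf : StrictMono f := fun s t hst => hc s.2 t.2 hst
  have hfa : ∀ x ∈ Finset.univ.image f, a ≤ (x : ℕ) := by
    intro x hx
    obtain ⟨t, -, rfl⟩ := Finset.mem_image.1 hx
    exact hac t t.2
  have hsplit := hpos (seg n 1 a ∪ Finset.univ.image f)
  rw [upperMinor_seg_union hH (by omega) hfa, flagMinor_eq_det_of_range_eq _ hf
    (by rw [Finset.coe_image, Finset.coe_univ, Set.image_univ])] at hsplit
  rw [← det_submatrix_eq_flagMinor_colFn H (strictMono_addLeft_mk hak) (range_seg hak) (g := f)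
    fun i => rfl]
  refine (pos_of_mul_pos_right hsplit (hpos _).le).trans_eq (congrArg Matrix.det ?_)
  ext i j
  exact congrFun (rowFn_of_lt H (by omega : a + (i : ℕ) < n)) (f j)

theorem flagMinor_insert_insert_pos_of_gap (φ : ℕ → Fin n → ℝ) {S : Finset (Fin n)}
    {a g b : Fin n} (hag : a < g) (hgb : g < b) (ha : a ∉ S) (hg : g ∉ S) (hb : b ∉ S)
    (hsmall : ∀ z ∉ S, a ≤ z → z ≤ b → 0 < flagMinor (fun t => φ (t + 1)) (insert z S))
    (hpos : 0 < flagMinor φ (insert a (insert g S)))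
    (hnonneg : 0 ≤ flagMinor φ (insert g (insert b S))) :
    0 < flagMinor φ (insert a (insert b S)) := by
  have plucker := flagMinor_threeTerm (φ := φ) (ψ := fun t => φ (t + 1)) rfl 0
    (fun t x => by rw [Fin.succAbove_zero, Fin.val_succ]) hag hgb ha hg hb
  refine pos_of_mul_pos_right ?_ (hsmall g hg hag.le hgb.le).le
  rw [plucker]
  exact add_pos_of_nonneg_of_pos (mul_nonneg (hsmall a ha le_rfl (hag.trans hgb).le).le hnonneg)
    (mul_pos (hsmall b hb (hag.trans hgb).le le_rfl) hpos)

theorem flagMinor_colFn_pos (hH : H.IsUpperTriangular) (hpos : ∀ J, 0 < upperMinor H J)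
    {I : Finset (Fin n)} (hI : I.card = k) (hc : StrictMonoOn c (Set.Iio k))
    (hcn : Set.MapsTo c (Set.Iio k) (Set.Iio n)) (hd : Dominated c I) :
    0 < flagMinor (colFn H c) I := by
  obtain ⟨lo, hi, hbound⟩ : ∃ lo hi : ℕ, ∀ x ∈ I, lo ≤ (x : ℕ) ∧ (x : ℕ) ≤ hi :=
    ⟨0, n, fun x _ => ⟨Nat.zero_le _, x.2.le⟩⟩
  induction hN : k + (hi - lo) using Nat.strong_induction_on generalizing k c I lo hi with
  | _ N ih =>
  subst hN
  obtain ⟨a, l, hal, rfl⟩ | ⟨S, a, g, b, hag, hgb, hg, hS, rfl⟩ := eq_seg_or_exists_gap I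
  · rw [card_seg hal] at hI
    subst hI
    exact flagMinor_colFn_seg_pos hH hpos hal hc hcn fun t ht => hd.le_of_seg hal hc.monotoneOn ht
  have ha : a ∉ S := fun h => (hS a h).1.false
  have hb : b ∉ S := fun h => (hS b h).2.false
  obtain rfl : k = S.card + 1 + 1 := by rw [← hI, card_insert_insert (hag.trans hgb).ne ha hb]
  have ha_lo := (hbound a (Finset.mem_insert_self _ _)).1
  have hb_hi := (hbound b (Finset.mem_insert_of_mem (Finset.mem_insert_self _ _))).2
  refine flagMinor_insert_insert_pos_of_gap _ hag hgb ha hg hb (fun z hz haz hzb => ?_) ?_ ?_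
  · exact ih (S.card + 1 + (b - a)) (by omega) (Finset.card_insert_of_notMem hz)
      (fun s hs t ht hst => hc (Nat.succ_lt_succ hs) (Nat.succ_lt_succ ht) (Nat.succ_lt_succ hst))
      (fun t ht => hcn (Nat.succ_lt_succ ht))
      (hd.tail_insert (fun x hx => (hS x hx).2.le) hzb (hag.trans hgb).ne ha hb hz) a b
      ((Finset.forall_mem_insert _ _ _).2
        ⟨⟨haz, hzb⟩, fun x hx => ⟨(hS x hx).1.le, (hS x hx).2.le⟩⟩) rfl
  · refine ih (S.card + 1 + 1 + (b - 1 - a)) (by omega) (card_insert_insert hag.ne ha hg) hc hcn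
      ?_ a (b - 1) ?_ rfl
    · rw [Finset.insert_comm] at hd ⊢
      exact hd.insert_of_le hgb.le (mt Finset.mem_insert.1 (not_or.2 ⟨hag.ne', hg⟩))
        (mt Finset.mem_insert.1 (not_or.2 ⟨(hag.trans hgb).ne', hb⟩))
    · simp only [Finset.forall_mem_insert]
      exact ⟨by omega, by omega, fun x hx => by have := hS x hx; omega⟩
  · by_contra! hneg
    have hcard := card_insert_insert hgb.ne hg hb
    refine hneg.not_gt (ih (S.card + 1 + 1 + (b - (a + 1))) (by omega) hcard hc hcn
      (dominated_of_flagMinor_ne_zero hH (hcard ▸ hc.monotoneOn) hneg.ne) (a + 1) b ?_ rfl)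
    simp only [Finset.forall_mem_insert]
    exact ⟨by omega, by omega, fun x hx => by have := hS x hx; omega⟩

theorem mem_BPlus_of_upperMinor_pos (hH : H ∈ B n) (hpos : ∀ J, 0 < upperMinor H J) :
    H ∈ BPlus n := by
  refine ⟨hH, fun k r c ⟨M, hM, hdet⟩ => ?_⟩
  let c' : ℕ → ℕ := fun t => if h : t < k then c ⟨t, h⟩ else 0
  have hc' (i : Fin k) : c' i = c i := dif_pos i.2
  have hmono : StrictMonoOn c' (Set.Iio k) := fun s hs t ht hst => by
    rw [hc' ⟨s, hs⟩, hc' ⟨t, ht⟩]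
    exact c.strictMono hst
  have hmaps : Set.MapsTo c' (Set.Iio k) (Set.Iio n) := fun t ht =>
    (hc' ⟨t, ht⟩).trans_lt (c ⟨t, ht⟩).2
  have hrange : Set.range r = (Finset.univ.map r.toEmbedding : Finset (Fin n)) := by
    rw [Finset.coe_map, Finset.coe_univ, Set.image_univ]
    rfl
  have hcard : (Finset.univ.map r.toEmbedding).card = k := by
    rw [Finset.card_map, Finset.card_fin]
  rw [det_submatrix_eq_flagMinor_colFn _ r.strictMono hrange hc'] at hdet ⊢
  have hdom := dominated_of_flagMinor_ne_zero (isUpperTriangular_of_mem_B hM)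
    (hcard.symm ▸ hmono.monotoneOn) hdet
  exact flagMinor_colFn_pos (isUpperTriangular_of_mem_B hH) hpos hcard hmono hmaps hdom

theorem antitranspose_mem_BPlus (hH : H ∈ BPlus n) : antitranspose H ∈ BPlus n :=
  mem_BPlus_of_upperMinor_pos (antitranspose_mem_B hH.1) fun J => by
    rw [← bar_bar J, ← rightMinor_eq_upperMinor_antitranspose]
    exact rightMinor_pos hH _

end Criterion

section LUFactorization

variable {ι K : Type*} [LinearOrder ι] [Fintype ι] [Field K]

theorem exists_rowElimination (M : Matrix ι ι K) (i : ι)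
    (hM : (M.toSquareBlockProp (· < i)).det ≠ 0) :
    ∃ w : ι → K, w i = 1 ∧ (∀ k, i < k → w k = 0) ∧ ∀ j < i, Matrix.vecMul w M j = 0 := by
  let M' : Matrix ι ι K := Matrix.of fun k j => if j < i then M k j else (1 : Matrix ι ι K) k j
  have hM' : IsUnit M' := by
    have hone : M'.toSquareBlockProp (fun j => ¬ j < i) = 1 := by
      ext k j
      simp only [M', Matrix.toSquareBlockProp_def, Matrix.of_apply, if_neg j.2, Matrix.one_apply,
        Subtype.ext_iff]
    have hblock : M'.toSquareBlockProp (· < i) = M.toSquareBlockProp (· < i) := by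
      ext k j
      simp only [M', Matrix.toSquareBlockProp_def, Matrix.of_apply, if_pos j.2]
    rw [Matrix.isUnit_iff_isUnit_det, Matrix.twoBlockTriangular_det' M' (· < i), hone, hblock,
      Matrix.det_one, mul_one]
    · exact hM.isUnit
    · intro k hk j hj
      simp only [M', Matrix.of_apply, if_neg hj,
        Matrix.one_apply_ne (hk.trans_le (not_lt.1 hj)).ne]
  obtain ⟨w, hw⟩ := Matrix.vecMul_surjective_iff_isUnit.2 hM' (Pi.single i 1)
  have apply_of_not_lt {k : ι} (hk : ¬ k < i) : w k = (Pi.single i 1 : ι → K) k := by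
    rw [← hw]
    simp only [M', Matrix.vecMul, dotProduct, Matrix.of_apply, if_neg hk, Matrix.one_apply, mul_ite,
      mul_one, mul_zero, Finset.sum_ite_eq', Finset.mem_univ, if_true]
  refine ⟨w, ?_, fun k hk => ?_, fun j hj => ?_⟩
  · rw [apply_of_not_lt (lt_irrefl i), Pi.single_eq_same]
  · rw [apply_of_not_lt hk.not_gt, Pi.single_eq_of_ne hk.ne']
  · have hwj := congrFun hw j
    rw [Pi.single_eq_of_ne hj.ne] at hwj
    simpa only [M', Matrix.vecMul, dotProduct, Matrix.of_apply, if_pos hj] using hwj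

theorem exists_unitLower_mul_isUpperTriangular (M : Matrix ι ι K)
    (hM : ∀ i, (M.toSquareBlockProp (· < i)).det ≠ 0) :
    ∃ L : Matrix ι ι K, L.IsLowerTriangular ∧ (∀ i, L i i = 1) ∧ (L * M).IsUpperTriangular := by
  choose L hdiag hlower helim using fun i => exists_rowElimination M i (hM i)
  exact ⟨Matrix.of L, fun i k hik => hlower i k hik, hdiag, fun i j hji => helim i j hji⟩

end LUFactorization

section Reversal

variable {n : ℕ}

theorem upperMinor_mul_of_unitLower {L : Matrix (Fin n) (Fin n) ℝ} (hL : L.IsLowerTriangular)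
    (hdiag : ∀ i, L i i = 1) (M : Matrix (Fin n) (Fin n) ℝ) (J : Finset (Fin n)) :
    upperMinor (L * M) J = upperMinor M J := by
  have hcard : J.card ≤ n := J.card_le_univ.trans_eq (Fintype.card_fin n)
  let top : Fin J.card → Fin n := Fin.castLE hcard
  have hdet : (L.submatrix top top).det = 1 := by
    have hlower : (L.submatrix top top).IsLowerTriangular := fun i k hik => hL hik
    rw [Matrix.det_of_isLowerTriangular _ hlower]
    exact Finset.prod_eq_one fun i _ => hdiag (top i)
  have hmul : (L * M).submatrix top (J.orderEmbOfFin rfl) =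
      L.submatrix top top * M.submatrix top (J.orderEmbOfFin rfl) := by
    ext i j
    refine (Fintype.sum_of_injective top (Fin.castLE_injective hcard) _ _ (fun k hk => ?_)
      fun k => rfl).symm
    have hik : top i < k := by
      by_contra! hki
      exact hk ⟨⟨k, (Fin.le_def.1 hki).trans_lt i.2⟩, rfl⟩
    exact mul_eq_zero_of_left (hL hik) _
  calc upperMinor (L * M) J = ((L * M).submatrix top (J.orderEmbOfFin rfl)).det := rfl
    _ = (M.submatrix top (J.orderEmbOfFin rfl)).det := by
      rw [hmul, Matrix.det_mul, hdet, one_mul]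
    _ = upperMinor M J := rfl

theorem det_toSquareBlockProp_lt (M : Matrix (Fin n) (Fin n) ℝ) (i : Fin n) :
    (M.toSquareBlockProp (· < i)).det = upperMinor M (seg n 1 i) := by
  let e : Fin i ≃ {j : Fin n // j < i} :=
    { toFun := fun t => ⟨⟨t, t.2.trans i.2⟩, t.2⟩
      invFun := fun j => ⟨j, j.2⟩ }
  have hseg := flagMinor_seg (rowFn M) (a := 0) (k := i) (by omega)
  simp only [zero_add] at hseg
  rw [upperMinor_eq_flagMinor, hseg, ← Matrix.det_submatrix_equiv_self e]
  congr 1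
  ext s t
  exact (congrFun (rowFn_of_lt M (s.2.trans i.2)) _).symm

/-- The sign of the order-reversing permutation of `k` letters. -/
def revSign (k : ℕ) : ℤˣ := Equiv.Perm.sign (Fin.revPerm : Equiv.Perm (Fin k))

theorem prod_revSign_div (k : ℕ) : ∏ t : Fin k, revSign (t + 1) / revSign t = revSign k := by
  rw [Fin.prod_univ_eq_prod_range (fun t => revSign (t + 1) / revSign t), Finset.prod_range_div,
    revSign, revSign, Subsingleton.elim (Fin.revPerm : Equiv.Perm (Fin 0)) 1, Equiv.Perm.sign_one,
    div_one]

/-- `G` with its columns reversed and its rows multiplied by signs, chosen such that the signs of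
the first `k` rows compensate for the reversal of `k` columns. -/
def signedReverse (G : Matrix (Fin n) (Fin n) ℝ) : Matrix (Fin n) (Fin n) ℝ :=
  Matrix.of fun i j => ((revSign (i + 1) / revSign i : ℤˣ) : ℤ) * G i j.rev

theorem upperMinor_signedReverse (G : Matrix (Fin n) (Fin n) ℝ) (J : Finset (Fin n)) :
    upperMinor (signedReverse G) J = upperMinor G (bar J) := by
  have hcard : J.card ≤ n := J.card_le_univ.trans_eq (Fintype.card_fin n)
  let A : Matrix (Fin J.card) (Fin J.card) ℝ :=
    Matrix.of fun i j => rowFn G i (J.orderEmbOfFin rfl j).rev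
  calc upperMinor (signedReverse G) J
      = (Matrix.of fun i j : Fin J.card =>
          (((revSign (i + 1) / revSign i : ℤˣ) : ℤ) : ℝ) * A i j).det := by
        rw [upperMinor]
        congr 1
        ext i j
        simp only [A, signedReverse, Matrix.of_apply, rowFn_of_lt G (i.2.trans_le hcard)]
    _ = ((revSign J.card : ℤ) : ℝ) * A.det := by
        rw [Matrix.det_mul_column, ← Int.cast_prod, ← Units.coe_prod, prod_revSign_div]
    _ = (A.submatrix id Fin.revPerm).det := (Matrix.det_permute' Fin.revPerm A).symm
    _ = upperMinor G (bar J) := (upperMinor_bar G J).symm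

theorem upperMinor_seg_union_singleton {G : Matrix (Fin n) (Fin n) ℝ} (hG : G.IsUpperTriangular)
    {i j : Fin n} (hij : i ≤ j) :
    upperMinor G (seg n 1 i ∪ {j}) = upperMinor G (seg n 1 i) * G i j := by
  rw [upperMinor_seg_union hG i.2.le fun x hx => by rwa [Finset.mem_singleton.1 hx],
    flagMinor_eq_det_of_range_eq _ (Subsingleton.strictMono fun _ : Fin 1 => j)
      (by rw [Set.range_const, Finset.coe_singleton]),
    Matrix.det_unique]
  exact congrArg _ (congrFun (rowFn_of_lt G i.2) j)

theorem eq_of_upperMinor_eq {G H : Matrix (Fin n) (Fin n) ℝ} (hG : G ∈ B n) (hH : H ∈ B n)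
    (h : ∀ J, upperMinor G J = upperMinor H J) : G = H := by
  ext i j
  rcases lt_or_ge j i with hji | hij
  · rw [hG.1 i j hji, hH.1 i j hji]
  · have hminor := h (seg n 1 i ∪ {j})
    rw [upperMinor_seg_union_singleton (isUpperTriangular_of_mem_B hG) hij,
      upperMinor_seg_union_singleton (isUpperTriangular_of_mem_B hH) hij, h] at hminor
    exact mul_left_cancel₀ (upperMinor_seg_one_ne_zero hH i.2.le) hminor

variable {G : Matrix (Fin n) (Fin n) ℝ}

theorem exists_isHat (hG : G ∈ BPlus n) : ∃ H, IsHat G H := by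
  obtain ⟨L, hL, hdiag, hU⟩ := exists_unitLower_mul_isUpperTriangular (signedReverse G) fun i => by
    rw [det_toSquareBlockProp_lt, upperMinor_signedReverse]
    exact (upperMinor_pos hG _).ne'
  have hminor (J : Finset (Fin n)) : upperMinor (L * signedReverse G) J = upperMinor G (bar J) := by
    rw [upperMinor_mul_of_unitLower hL hdiag, upperMinor_signedReverse]
  have hpos (J : Finset (Fin n)) : 0 < upperMinor (L * signedReverse G) J := by
    rw [hminor]
    exact upperMinor_pos hG _
  have hB : L * signedReverse G ∈ B n := by
    refine ⟨fun i j hij => hU hij, ?_⟩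
    rw [Matrix.isUnit_iff_isUnit_det, ← upperMinor_univ]
    exact (hpos _).ne'.isUnit
  exact ⟨_, mem_BPlus_of_upperMinor_pos hB hpos, hminor⟩

theorem existsUnique_isHat (hG : G ∈ BPlus n) : ∃! H, IsHat G H :=
  existsUnique_of_exists_of_unique (exists_isHat hG) fun _ _ hH hH' =>
    eq_of_upperMinor_eq hH.1.1 hH'.1.1 fun J => (hH.2 J).trans (hH'.2 J).symm

theorem isCheck_iff_isHat_antitranspose {H : Matrix (Fin n) (Fin n) ℝ} :
    IsCheck G H ↔ IsHat (antitranspose G) (antitranspose H) := by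
  refine and_congr ⟨antitranspose_mem_BPlus, fun h => ?_⟩ ⟨fun h J => ?_, fun h I => ?_⟩
  · rw [← antitranspose_antitranspose H]
    exact antitranspose_mem_BPlus h
  · simpa only [rightMinor_eq_upperMinor_antitranspose, bar_bar] using h (bar J)
  · simpa only [rightMinor_eq_upperMinor_antitranspose] using h (bar I)

theorem existsUnique_isCheck (hG : G ∈ BPlus n) : ∃! H, IsCheck G H := by
  obtain ⟨H, hH, huniq⟩ := existsUnique_isHat (antitranspose_mem_BPlus hG)
  refine ⟨antitranspose H, isCheck_iff_isHat_antitranspose.2 ?_, fun H' hH' => ?_⟩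
  · rwa [antitranspose_antitranspose]
  · rw [← huniq _ (isCheck_iff_isHat_antitranspose.1 hH'), antitranspose_antitranspose]

end Reversal

section DilogSums

variable {n : ℕ}

theorem mem_T {t : ℕ × ℕ × ℕ} : t ∈ T n ↔ 1 ≤ t.1 ∧ t.1 < t.2.1 ∧ t.2.1 < t.2.2 ∧ t.2.2 ≤ n := by
  simp only [T, Finset.mem_filter, Finset.mem_product, Finset.mem_Icc]
  omega

theorem dilogSum_congr {Z W : ℕ → ℕ → ℕ → ℝ}
    (h : ∀ a b c, 1 ≤ a → a < b → b < c → c ≤ n → Z a b c = W a b c) :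
    dilogSum n Z = dilogSum n W := by
  refine Finset.sum_congr rfl fun t ht => ?_
  obtain ⟨ha, hab, hbc, hc⟩ := mem_T.1 ht
  rw [h _ _ _ ha hab hbc hc]

theorem dilogSumInv_eq_dilogSum (Z : ℕ → ℕ → ℕ → ℝ) :
    dilogSumInv n Z = dilogSum n fun a b c => 1 / Z a b c := rfl

theorem dilogSum_add_dilogSumInv {Z : ℕ → ℕ → ℕ → ℝ} (hZ : ∀ a b c, 0 < Z a b c) :
    dilogSum n Z + dilogSumInv n Z = (T n).card • (2 * ell 1) := by
  rw [dilogSum, dilogSumInv, ← Finset.sum_add_distrib, ← Finset.sum_const]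
  exact Finset.sum_congr rfl fun t _ => ell_add_ell_one_div (hZ _ _ _)

theorem dilogSumInv_eq_dilogSumInv_iff {Z W : ℕ → ℕ → ℕ → ℝ} (hZ : ∀ a b c, 0 < Z a b c)
    (hW : ∀ a b c, 0 < W a b c) :
    dilogSumInv n Z = dilogSumInv n W ↔ dilogSum n Z = dilogSum n W := by
  have hZW := (dilogSum_add_dilogSumInv (n := n) hZ).trans (dilogSum_add_dilogSumInv hW).symm
  constructor <;> intro h <;> linarith

theorem dilogSum_reverse (Z : ℕ → ℕ → ℕ → ℝ) :
    dilogSum n (fun a b c => Z (n + 1 - c) (n + 1 - b) (n + 1 - a)) = dilogSum n Z := by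
  refine Finset.sum_nbij' (fun t => (n + 1 - t.2.2, n + 1 - t.2.1, n + 1 - t.1))
    (fun t => (n + 1 - t.2.2, n + 1 - t.2.1, n + 1 - t.1)) ?_ ?_ ?_ ?_ fun _ _ => rfl
  all_goals
    intro t ht
    simp only [mem_T, Prod.ext_iff] at ht ⊢
    omega

theorem dilogSum_reflect_middle (Z : ℕ → ℕ → ℕ → ℝ) :
    dilogSum n (fun a b c => Z a (a + c - b) c) = dilogSum n Z := by
  refine Finset.sum_nbij' (fun t => (t.1, t.1 + t.2.2 - t.2.1, t.2.2))
    (fun t => (t.1, t.1 + t.2.2 - t.2.1, t.2.2)) ?_ ?_ ?_ ?_ fun _ _ => rfl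
  all_goals
    intro t ht
    simp only [mem_T, Prod.ext_iff, true_and, and_true] at ht ⊢
    omega

variable {G H : Matrix (Fin n) (Fin n) ℝ}

theorem Ylow_pos (hG : G ∈ BPlus n) (a b c : ℕ) : 0 < Ylow G a b c :=
  have hpos := rightMinor_pos hG
  div_pos (mul_pos (hpos _) (hpos _)) (mul_pos (hpos _) (hpos _))

theorem Ytlow_pos (hG : G ∈ BPlus n) (a b c : ℕ) : 0 < Ytlow G a b c :=
  have hpos := rightMinor_pos hG
  div_pos (mul_pos (hpos _) (hpos _)) (mul_pos (hpos _) (hpos _))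

theorem Yup_pos (hG : G ∈ BPlus n) (a b c : ℕ) : 0 < Yup G a b c :=
  have hpos := upperMinor_pos hG
  div_pos (mul_pos (hpos _) (hpos _)) (mul_pos (hpos _) (hpos _))

theorem Ytup_pos (hG : G ∈ BPlus n) (a b c : ℕ) : 0 < Ytup G a b c :=
  have hpos := upperMinor_pos hG
  div_pos (mul_pos (hpos _) (hpos _)) (mul_pos (hpos _) (hpos _))

theorem dilogSum_Ytlow (hG : G ∈ BPlus n) : dilogSum n (Ytlow G) = dilogSum n (Ylow G) := by
  rw [dilogSum_congr fun _ _ _ ha hab hbc _ => Ylow_eq_exchangeRatio G ha hab hbc,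
    dilogSum_congr fun _ _ _ ha hab hbc _ => Ytlow_eq_exchangeRatio G ha hab hbc]
  exact ((threeTerm_comp_idxSet (rightMinor_threeTerm G)).sum_pathEll
    fun _ => rightMinor_pos hG _).symm

theorem dilogSumInv_Ytup_eq_Yup (hG : G ∈ BPlus n) :
    dilogSumInv n (Ytup G) = dilogSumInv n (Yup G) := by
  rw [dilogSumInv_eq_dilogSum, dilogSumInv_eq_dilogSum,
    dilogSum_congr fun _ _ _ ha hab hbc _ => one_div_Yup_eq_exchangeRatio G ha hab hbc,
    dilogSum_congr fun _ _ _ ha hab hbc _ => one_div_Ytup_eq_exchangeRatio G ha hab hbc]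
  exact ((threeTerm_comp_idxSet (upperMinor_threeTerm G)).sum_pathEll
    fun _ => upperMinor_pos hG _).symm

theorem dilogSum_Ytup (hG : G ∈ BPlus n) : dilogSum n (Ytup G) = dilogSum n (Ylow G) := by
  rw [← dilogSum_reflect_middle (Ytup G)]
  exact dilogSum_congr fun _ _ _ ha hab hbc hc => (Ylow_eq_Ytup hG.1 ha hab hbc hc).symm

theorem dilogSum_Yup (hG : G ∈ BPlus n) : dilogSum n (Yup G) = dilogSum n (Ylow G) := by
  rw [← dilogSum_Ytup hG, ← dilogSumInv_eq_dilogSumInv_iff (Yup_pos hG) (Ytup_pos hG),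
    dilogSumInv_Ytup_eq_Yup hG]

theorem dilogSumInv_Ytlow (hG : G ∈ BPlus n) :
    dilogSumInv n (Ytlow G) = dilogSumInv n (Ylow G) :=
  (dilogSumInv_eq_dilogSumInv_iff (Ytlow_pos hG) (Ylow_pos hG)).2 (dilogSum_Ytlow hG)

theorem dilogSumInv_Ytup (hG : G ∈ BPlus n) : dilogSumInv n (Ytup G) = dilogSumInv n (Ylow G) :=
  (dilogSumInv_eq_dilogSumInv_iff (Ytup_pos hG) (Ylow_pos hG)).2 (dilogSum_Ytup hG)

theorem dilogSumInv_Yup (hG : G ∈ BPlus n) : dilogSumInv n (Yup G) = dilogSumInv n (Ylow G) :=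
  (dilogSumInv_eq_dilogSumInv_iff (Yup_pos hG) (Ylow_pos hG)).2 (dilogSum_Yup hG)

theorem IsCheck.Ylow_eq_one_div_Ytlow (h : IsCheck G H) {a b c : ℕ} (ha : 1 ≤ a) (hab : a < b)
    (hbc : b < c) (hc : c ≤ n) :
    Ylow H a b c = 1 / Ytlow G (n + 1 - c) (n + 1 - b) (n + 1 - a) := by
  rw [Ylow, Ytlow, one_div_div, mul_comm (rightMinor H (seg n a b ∪ _)),
    mul_comm (rightMinor H (seg n a (b - 1) ∪ _)), h.2, h.2, h.2, h.2]
  congr 3 <;> ext x <;> have := x.2 <;>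
    simp only [mem_bar, Finset.mem_union, mem_seg, Fin.val_rev] <;> omega

theorem IsHat.Ytup_eq_one_div_Yup (h : IsHat G H) {a b c : ℕ} (ha : 1 ≤ a) (hab : a < b)
    (hbc : b < c) (hc : c ≤ n) :
    Ytup H a b c = 1 / Yup G (n + 1 - c) (n + 1 - b) (n + 1 - a) := by
  rw [Ytup, Yup, one_div_div, mul_comm (upperMinor H (seg n 1 a ∪ seg n b (c - 1))),
    mul_comm (upperMinor H (seg n 1 a ∪ seg n (b + 1) (c - 1))), h.2, h.2, h.2, h.2]
  congr 3 <;> ext x <;> have := x.2 <;>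
    simp only [mem_bar, Finset.mem_union, mem_seg, Fin.val_rev] <;> omega

theorem IsCheck.dilogSum_Ylow (hG : G ∈ BPlus n) (h : IsCheck G H) :
    dilogSum n (Ylow H) = dilogSumInv n (Ylow G) := by
  rw [dilogSum_congr fun _ _ _ => h.Ylow_eq_one_div_Ytlow,
    dilogSum_reverse fun a b c => 1 / Ytlow G a b c]
  exact dilogSumInv_Ytlow hG

theorem IsHat.dilogSum_Ylow (hG : G ∈ BPlus n) (h : IsHat G H) :
    dilogSum n (Ylow H) = dilogSumInv n (Ylow G) := by
  rw [← dilogSum_Ytup h.1, dilogSum_congr fun _ _ _ => h.Ytup_eq_one_div_Yup,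
    dilogSum_reverse fun a b c => 1 / Yup G a b c]
  exact dilogSumInv_Yup hG

end DilogSums

end TotPosDilog

theorem theorem3p9 (n : ℕ) (hn : 2 ≤ n) (G : Matrix (Fin n) (Fin n) ℝ)
    (hG : G ∈ TotPosDilog.BPlus n) :
    (∃! Gc, TotPosDilog.IsCheck G Gc) ∧
    (∃! Gh, TotPosDilog.IsHat G Gh) ∧
    ∀ Gc Gh : Matrix (Fin n) (Fin n) ℝ,
      TotPosDilog.IsCheck G Gc → TotPosDilog.IsHat G Gh →
      -- the chain of twelve equal sums, as eleven consecutive equalities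
      TotPosDilog.dilogSum n (TotPosDilog.Ylow Gc) =
        TotPosDilog.dilogSumInv n (TotPosDilog.Ylow G) ∧
      TotPosDilog.dilogSumInv n (TotPosDilog.Ylow G) =
        TotPosDilog.dilogSum n (TotPosDilog.Ylow Gh) ∧
      TotPosDilog.dilogSum n (TotPosDilog.Ylow Gh) =
        TotPosDilog.dilogSum n (TotPosDilog.Ytup Gc) ∧
      TotPosDilog.dilogSum n (TotPosDilog.Ytup Gc) =
        TotPosDilog.dilogSumInv n (TotPosDilog.Ytup G) ∧
      TotPosDilog.dilogSumInv n (TotPosDilog.Ytup G) =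
        TotPosDilog.dilogSum n (TotPosDilog.Ytup Gh) ∧
      TotPosDilog.dilogSum n (TotPosDilog.Ytup Gh) =
        TotPosDilog.dilogSum n (TotPosDilog.Ytlow Gc) ∧
      TotPosDilog.dilogSum n (TotPosDilog.Ytlow Gc) =
        TotPosDilog.dilogSumInv n (TotPosDilog.Ytlow G) ∧
      TotPosDilog.dilogSumInv n (TotPosDilog.Ytlow G) =
        TotPosDilog.dilogSum n (TotPosDilog.Ytlow Gh) ∧
      TotPosDilog.dilogSum n (TotPosDilog.Ytlow Gh) =
        TotPosDilog.dilogSum n (TotPosDilog.Yup Gc) ∧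
      TotPosDilog.dilogSum n (TotPosDilog.Yup Gc) =
        TotPosDilog.dilogSumInv n (TotPosDilog.Yup G) ∧
      TotPosDilog.dilogSumInv n (TotPosDilog.Yup G) =
        TotPosDilog.dilogSum n (TotPosDilog.Yup Gh) := by
  refine ⟨TotPosDilog.existsUnique_isCheck hG, TotPosDilog.existsUnique_isHat hG,
    fun Gc Gh hGc hGh => ?_⟩
  simp only [hGc.dilogSum_Ylow hG, hGh.dilogSum_Ylow hG,
    TotPosDilog.dilogSum_Ytup hGc.1, TotPosDilog.dilogSum_Ytup hGh.1,
    TotPosDilog.dilogSum_Ytlow hGc.1, TotPosDilog.dilogSum_Ytlow hGh.1,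
    TotPosDilog.dilogSum_Yup hGc.1, TotPosDilog.dilogSum_Yup hGh.1,
    TotPosDilog.dilogSumInv_Ytup hG, TotPosDilog.dilogSumInv_Ytlow hG,
    TotPosDilog.dilogSumInv_Yup hG, and_self]
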